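/- Let $d,q\ge 1$, let $\Omega\subset\mathbb R^d$ be open and bounded, and let $m$ be the Lebesgue measure restricted to $\Omega$. Let $W:\mathbb R^{q\times d}\to[0,+\infty)$ be convex and finite everywhere, and assume that there are $p\in[1,+\infty)$, $C_1>0$, $C_2\ge 0$ with $W(v)\ge C_1|v|^p-C_2$ for all $v$. Write $a\cdot b=\sum_{ij}a_{ij}b_{ij}$ and $|\cdot|$ for the Frobenius scalar product and norm on $\mathbb R^{q\times d}$, $W^*(r)=\sup_v\,(r\cdot v-W(v))\in(-\infty,+\infty]$ for the Legendre transform and $W'_\infty(v)=\lim_{t\to+\infty}W(tv)/t\in[0,+\infty]$ for the recession function of $W$. For a finite non-negative Borel measure $\mu$ on $\Omega\times\mathbb R^q$ and a finite $q\times d$ matrix-valued Borel measure $J$ on $\Omega\times\mathbb R^q$ with Radon–Nikodym decomposition $J=v\mu+J^\perp$ (where $J^\perp\perp\mu$), set $$\mathcal B_W(\mu,J)=\int W(v)\,d\mu+\int W'_\infty\!\left(\frac{dJ^\perp}{d|J^\perp|}\right)d|J^\perp| .$$ For $\varphi=(\varphi_j)_{j\le d}:\Omega\times\mathbb R^q\to\mathbb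 R^d$ set $\nabla_x\cdot\varphi=\sum_j\partial_{x_j}\varphi_j$ and $\nabla_y\varphi=(\partial_{y_i}\varphi_j)_{1\le i\le q,\,1\le j\le d}$. We say that $\nabla_x\mu+\nabla_y\cdot J=0$ if $$\int\nabla_x\cdot\varphi\,d\mu+\int\nabla_y\varphi\cdot dJ=0\qquad\text{for all }\varphi\in C^\infty_c(\Omega\times\mathbb R^q,\mathbb R^d).$$ For $\mu$ with first marginal $m$ let $$\mathcal T_{E,\mathrm{Eul}}(\mu)=\min_J\{\mathcal B_W(\mu,J):\ \nabla_x\mu+\nabla_y\cdot J=0\}\in[0,+\infty],$$ with value $+\infty$ if there is no such $J$. Theorem (duality for $\mathcal T_{E,\mathrm{Eul}}$). For every finite non-negative Borel measure $\mu$ on $\Omega\times\mathbb R^q$ with first marginal $m$, $$\mathcal T_{E,\mathrm{Eul}}(\mu)=\sup_{\varphi}\left\{-\int_{\Omega\times\mathbb R^q}\bigl(\nabla_x\cdot\varphi+W^*(\nabla_y\varphi)\bigr)\,d\mu\ :\ \varphi\in C^1_c(\Omega\times\mathbb R^q,\mathbb R^d),\ W^*(\nabla_y\varphi)<+\infty\text{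 on }\Omega\times\mathbb R^q\right\}$$ as elements of $[0,+\infty]$ (the integral on the right lies in $(-\infty,+\infty]$), and the minimum defining $\mathcal T_{E,\mathrm{Eul}}(\mu)$ is attained whenever some $J$ satisfies the constraint. -/

import Mathlib

open MeasureTheory Filter
open scoped ENNReal ContDiff

noncomputable section

namespace EulerianLifting

/-- `ℝⁿ` with its Euclidean structure. -/
abbrev Euc (n : ℕ) : Type := EuclideanSpace ℝ (Fin n)

/-- Real `q × d` matrices, with the canonical (Frobenius) scalar product `a · b = ∑ᵢⱼ aᵢⱼ bᵢⱼ`. -/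
abbrev Mat (q d : ℕ) : Type := EuclideanSpace ℝ (Fin q × Fin d)

variable {d q : ℕ}

/-! ### Functions on matrices -/

/-- The recession function `W'_∞(v) = lim_{t → +∞} W(t v) / t ∈ [0, +∞]` of a nonnegative `W`.
For convex `W` the limit exists, so that it agrees with the upper limit used here. -/
def recession (W : Mat q d → ℝ) (v : Mat q d) : ℝ≥0∞ :=
  limsup (fun t : ℝ => ENNReal.ofReal (W (t • v) / t)) atTop

/-- The Legendre transform `W*(r) = sup_v (r · v - W(v)) ∈ [-∞, +∞]`. -/
def legendre (W : Mat q d → ℝ) (r : Mat q d) : EReal :=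
  ⨆ v : Mat q d, ((inner ℝ r v - W v : ℝ) : EReal)

/-! ### Differential operators on test functions -/

/-- `∇ₓ · φ = ∑ⱼ ∂φⱼ/∂xⱼ`. -/
def divX (φ : Euc d × Euc q → Euc d) (z : Euc d × Euc q) : ℝ :=
  ∑ j : Fin d, fderiv ℝ φ z (EuclideanSpace.single j 1, 0) j

/-- `∇_y φ`, the `q × d` matrix with entries `(∇_y φ)ᵢⱼ = ∂φⱼ/∂yᵢ`. -/
def gradY (φ : Euc d × Euc q → Euc d) (z : Euc d × Euc q) : Mat q d :=
  WithLp.toLp 2 fun ij : Fin q × Fin d => fderiv ℝ φ z (0, EuclideanSpace.single ij.1 1) ij.2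

/-- `φ ∈ Cⁿ_c(Ω × ℝ^q, ℝ^d)`: the function (extended by zero to `ℝ^d × ℝ^q`) is of class `Cⁿ`
and its support is a compact subset of `Ω × ℝ^q`. -/
structure IsTest (n : ℕ∞) (Ω : Set (Euc d)) (φ : Euc d × Euc q → Euc d) : Prop where
  contDiff : ContDiff ℝ n φ
  hasCompactSupport : HasCompactSupport φ
  tsupport_subset : tsupport φ ⊆ Ω ×ˢ Set.univ

/-! ### Matrix-valued measures -/

section Measures

variable {X : Type*} [MeasurableSpace X]

/-- The entry `Jᵢⱼ`, a finite signed measure, of a matrix-valued measure `J`. -/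
def entry (J : VectorMeasure X (Mat q d)) (ij : Fin q × Fin d) : SignedMeasure X :=
  J.mapRange (EuclideanSpace.proj (𝕜 := ℝ) ij : Mat q d →L[ℝ] ℝ).toLinearMap.toAddMonoidHom
    (EuclideanSpace.proj (𝕜 := ℝ) ij : Mat q d →L[ℝ] ℝ).continuous

/-- The Radon-Nikodym density `dJ/dμ` of a matrix-valued measure, entry by entry. -/
def density (J : VectorMeasure X (Mat q d)) (μ : Measure X) (z : X) : Mat q d :=
  WithLp.toLp 2 fun ij => (entry J ij).rnDeriv μ z

/-- The singular part `J^⊥` in the Radon-Nikodym decomposition `J = v μ + J^⊥`. -/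
def singPart (J : VectorMeasure X (Mat q d)) (μ : Measure X) : VectorMeasure X (Mat q d) :=
  J - μ.withDensityᵥ (density J μ)

/-- The functional
`B_W(μ, J) = ∫ W(v) dμ + ∫ W'_∞(dJ^⊥/d|J^⊥|) d|J^⊥|`, where `J = v μ + J^⊥`. -/
def energy (W : Mat q d → ℝ) (μ : Measure X) (J : VectorMeasure X (Mat q d)) : ℝ≥0∞ :=
  ∫⁻ z, ENNReal.ofReal (W (density J μ z)) ∂μ +
    ∫⁻ z, recession W (density (singPart J μ) (singPart J μ).variation z)
      ∂(singPart J μ).variation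

/-- The integral of an extended-real function, as the difference of the integrals of its positive
and negative parts (meaningful as soon as one of the two is finite). -/
def erealIntegral (μ : Measure X) (g : X → EReal) : EReal :=
  ((∫⁻ z, (g z).toENNReal ∂μ : ℝ≥0∞) : EReal) - ((∫⁻ z, (-g z).toENNReal ∂μ : ℝ≥0∞) : EReal)

end Measures

/-! ### The Eulerian lifting -/

variable {Ω : Set (Euc d)}

/-- The equation `∇ₓ μ + ∇_y · J = 0` in the weak sense on `Ω × ℝ^q`. -/
def ContinuityEq (μ : Measure (Ω × Euc q)) (J : VectorMeasure (Ω × Euc q) (Mat q d)) : Prop :=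
  ∀ φ : Euc d × Euc q → Euc d, IsTest (⊤ : ℕ∞) Ω φ →
    ∫ z : Ω × Euc q, divX φ ((z.1 : Euc d), z.2) ∂μ +
      ∑ ij : Fin q × Fin d, ∫ᵛ z : Ω × Euc q, gradY φ ((z.1 : Euc d), z.2) ij ∂•(entry J ij) = 0

/-- The Eulerian lifting
`T_{E,Eul}(μ) = inf {B_W(μ, J) : ∇ₓ μ + ∇_y · J = 0} ∈ [0, +∞]`. -/
def lifting (W : Mat q d → ℝ) (μ : Measure (Ω × Euc q)) : ℝ≥0∞ :=
  ⨅ (J : VectorMeasure (Ω × Euc q) (Mat q d)) (_ : ContinuityEq μ J), energy W μ J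

/-- The dual objective `-∫ (∇ₓ · φ + W*(∇_y φ)) dμ`. -/
def dualValue (W : Mat q d → ℝ) (μ : Measure (Ω × Euc q)) (φ : Euc d × Euc q → Euc d) : EReal :=
  -erealIntegral μ fun z : Ω × Euc q =>
    ((divX φ ((z.1 : Euc d), z.2) : ℝ) : EReal) + legendre W (gradY φ ((z.1 : Euc d), z.2))

/-- Admissible dual functions: `φ ∈ C¹_c(Ω × ℝ^q, ℝ^d)` with `W*(∇_y φ) < +∞` on `Ω × ℝ^q`. -/
def DualAdmissible (W : Mat q d → ℝ) (Ω : Set (Euc d)) (φ : Euc d × Euc q → Euc d) : Prop :=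
  IsTest 1 Ω φ ∧ ∀ x ∈ Ω, ∀ y : Euc q, legendre W (gradY φ (x, y)) < ⊤

end EulerianLifting

end

/-!
The argument is convex duality between `∫ W*(ψ) dμ` on continuous matrix fields `ψ` and `B_W(μ, ·)`
on matrix-valued measures. A statement `W*(r) ≤ c` with `c` real is used throughout in the form
`IsAffineMinorant W r c`: the affine function `v ↦ r · v - c` lies below `W`.

*Lower bound for the lifting.* Mollification extends `∇ₓ μ + ∇_y · J = 0` from smooth to `C¹` test
functions (`ContinuityEq.of_isTest_one`). Splitting `J = v μ + h |J^⊥|`, the inequalities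
`r · v - W(v) ≤ W*(r)` and, for `W*(r) < ∞`, `r · h ≤ W'_∞(h)` give that every dual value is at most
every energy (`dualValue_le_energy`).

*Upper bound and attainment.* Let the dual supremum be a real number `S`. The linear form
`∇_y φ ↦ -∫ ∇ₓ · φ dμ` on gradients is dominated by the convex functional `ψ ↦ ∫ W*(ψ) dμ + S`.
The domination is homogenised into positivity on a convex cone (`costCone`), and the M. Riesz
extension theorem yields a linear form `Λ` on all continuous compactly supported fields, still
dominated by this functional (`IsDualBound.exists_linearMap`). The linear growth of `W` makes `W*`
bounded near `0`, hence `Λ` bounded, so `Λ` is integration against a matrix-valued measure `J`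
(`exists_measure_sub_of_bounded`), which solves the continuity equation. It remains that the
domination forces `B_W(μ, J) ≤ S` (`lintegral_add_lintegral_recession_le`). There `W` is the
supremum of countably many affine minorants `r_k · v - c_k`, and `W'_∞` is at most the supremum of
the `r_k · h`. Each finite maximum of these is realised by a measurable choice of index; the
corresponding piecewise constant field is a limit of continuous compactly supported convex
combinations of the `r_k`, to which the domination applies, and monotone convergence concludes.
Thus one and the same `J` has energy at most `S`, which is both the equality and the attainment.
If the dual supremum is `+∞`, every competitor has infinite energy.
-/

noncomputable section

namespace EulerianLifting

open scoped CompactlySupported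

variable {d q : ℕ}

/-! ### Affine minorants of a convex function -/

/-- The affine function `v ↦ r · v - c` is a minorant of `W`; equivalently, `W*(r) ≤ c`. -/
def IsAffineMinorant (W : Mat q d → ℝ) (r : Mat q d) (c : ℝ) : Prop :=
  ∀ v, inner ℝ r v - c ≤ W v

theorem legendre_le_coe_iff {W : Mat q d → ℝ} {r : Mat q d} {c : ℝ} :
    legendre W r ≤ (c : EReal) ↔ IsAffineMinorant W r c := by
  simp only [legendre, iSup_le_iff, EReal.coe_le_coe_iff, IsAffineMinorant]
  exact forall_congr' fun v => sub_le_comm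

theorem coe_le_legendre (W : Mat q d → ℝ) (r v : Mat q d) :
    ((inner ℝ r v - W v : ℝ) : EReal) ≤ legendre W r :=
  le_iSup (fun v => ((inner ℝ r v - W v : ℝ) : EReal)) v

theorem exists_isAffineMinorant_of_legendre_lt_top {W : Mat q d → ℝ} {r : Mat q d}
    (h : legendre W r < ⊤) : ∃ c, IsAffineMinorant W r c := by
  refine ⟨(legendre W r).toReal, legendre_le_coe_iff.1 ?_⟩
  exact EReal.le_coe_toReal h.ne

theorem isAffineMinorant_zero {W : Mat q d → ℝ} (hW : ∀ v, 0 ≤ W v) :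
    IsAffineMinorant W 0 0 := fun v => by simpa using hW v

theorem continuous_of_convexOn_univ {W : Mat q d → ℝ} (hW : ConvexOn ℝ Set.univ W) :
    Continuous W := by
  simpa [continuousOn_univ] using hW.continuousOn_interior

/-- A nonnegative convex function is the supremum of countably many affine minorants. The zero minorant
is put first, so that finite maxima taken from the start of the sequence are nonnegative. -/
theorem exists_affineMinorant_seq {W : Mat q d → ℝ} (hW0 : ∀ v, 0 ≤ W v)
    (hW : ConvexOn ℝ Set.univ W) :
    ∃ (r : ℕ → Mat q d) (c : ℕ → ℝ), (∀ n, IsAffineMinorant W (r n) (c n)) ∧ r 0 = 0 ∧ c 0 = 0 ∧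
      ∀ v a, a < W v → ∃ n, a < inner ℝ (r n) v - c n := by
  obtain ⟨l, b, hle, hsup⟩ := ConvexOn.real_univ_sSup_of_nat_affine_eq
    (continuous_of_convexOn_univ hW).lowerSemicontinuous hW
  have key : ∀ n v, inner ℝ ((InnerProductSpace.toDual ℝ (Mat q d)).symm (l n)) v = l n v :=
    fun n v => InnerProductSpace.toDual_symm_apply
  refine ⟨fun n => n.casesOn 0 fun n => (InnerProductSpace.toDual ℝ (Mat q d)).symm (l n),
    fun n => n.casesOn 0 fun n => - b n, ?_, rfl, rfl, ?_⟩
  · rintro (_ | n)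
    · exact isAffineMinorant_zero hW0
    · intro v
      have := hle n v
      simpa [key] using this
  · intro v a ha
    have h2 : (⨆ i, (l i v + b i)) = W v := by
      rw [← hsup, iSup_apply]
      rfl
    rw [← h2] at ha
    obtain ⟨n, hn⟩ := exists_lt_of_lt_ciSup ha
    exact ⟨n + 1, by simpa [key] using hn⟩

/-- On the domain of `W*`, the recession function dominates the linear form: let `t → ∞` in
`r · v - c / t ≤ W(t v) / t`. -/
theorem IsAffineMinorant.inner_le_recession {W : Mat q d → ℝ} {r : Mat q d} {c : ℝ}
    (h : IsAffineMinorant W r c) (v : Mat q d) :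
    ENNReal.ofReal (inner ℝ r v) ≤ recession W v := by
  have h1 : Tendsto (fun t : ℝ => ENNReal.ofReal (inner ℝ r v - c / t)) atTop
      (nhds (ENNReal.ofReal (inner ℝ r v))) := by
    refine (ENNReal.continuous_ofReal.tendsto _).comp ?_
    simpa using (tendsto_const_nhds (x := inner ℝ r v)).sub
      (tendsto_const_nhds (x := c).div_atTop tendsto_id)
  rw [← h1.limsup_eq]
  refine limsup_le_limsup ?_
  filter_upwards [eventually_gt_atTop (0 : ℝ)] with t ht
  refine ENNReal.ofReal_le_ofReal ?_
  rw [le_div_iff₀ ht]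
  have := h (t • v)
  rw [inner_smul_right] at this
  calc (inner ℝ r v - c / t) * t = t * inner ℝ r v - c := by field_simp
    _ ≤ _ := this

/-- The constants `c n` disappear in the limit because `-c n ≤ W 0` for every minorant. -/
theorem recession_le_iSup {W : Mat q d → ℝ} {r : ℕ → Mat q d} {c : ℕ → ℝ}
    (hm : ∀ n, IsAffineMinorant W (r n) (c n))
    (hs : ∀ v a, a < W v → ∃ n, a < inner ℝ (r n) v - c n) (v : Mat q d) :
    recession W v ≤ ⨆ n, ENNReal.ofReal (inner ℝ (r n) v) := by
  set A := ⨆ n, ENNReal.ofReal (inner ℝ (r n) v) with hA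
  have h1 : Tendsto (fun t : ℝ => A + ENNReal.ofReal (W 0 / t)) atTop (nhds (A + 0)) := by
    refine tendsto_const_nhds.add ?_
    have := (ENNReal.continuous_ofReal.tendsto _).comp
      (tendsto_const_nhds (x := W 0).div_atTop tendsto_id)
    simpa [Function.comp_def] using this
  rw [← add_zero A, ← h1.limsup_eq]
  refine limsup_le_limsup ?_
  filter_upwards [eventually_gt_atTop (0 : ℝ)] with t ht
  refine ENNReal.le_of_forall_pos_le_add fun ε hε _ => ?_
  obtain ⟨n, hn⟩ := hs (t • v) (W (t • v) - ε * t) (by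
    have : 0 < (ε : ℝ) * t := by positivity
    linarith)
  rw [inner_smul_right] at hn
  have h0 := hm n 0
  simp only [inner_zero_right, zero_sub] at h0
  have h2 : W (t • v) / t ≤ inner ℝ (r n) v + W 0 / t + ε := by
    rw [div_le_iff₀ ht]
    have : (inner ℝ (r n) v + W 0 / t + ε) * t = t * inner ℝ (r n) v + W 0 + ε * t := by
      field_simp
    rw [this]; linarith
  calc ENNReal.ofReal (W (t • v) / t) ≤ ENNReal.ofReal (inner ℝ (r n) v + W 0 / t + ε) :=
        ENNReal.ofReal_le_ofReal h2
    _ ≤ ENNReal.ofReal (inner ℝ (r n) v) + ENNReal.ofReal (W 0 / t) + ENNReal.ofReal ε :=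
        ENNReal.ofReal_add_le.trans (add_le_add_left ENNReal.ofReal_add_le _)
    _ ≤ A + ENNReal.ofReal (W 0 / t) + ε := by
        gcongr
        · exact le_iSup (fun n => ENNReal.ofReal (inner ℝ (r n) v)) n
        · simp

/-! ### From domination on continuous fields to a bound on the energy -/

section Simplex
variable {n : ℕ}

/-- A continuous retraction of `ℝⁿ` onto `{x | 0 ≤ x, ∑ x ≤ 1}`. It fixes `0`, so it preserves compact
supports. -/
def simplexProj (x : Fin n → ℝ) (k : Fin n) : ℝ := max (x k) 0 / max 1 (∑ j, max (x j) 0)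

theorem simplexProj_nonneg (x : Fin n → ℝ) (k : Fin n) : 0 ≤ simplexProj x k := by
  unfold simplexProj; positivity

theorem sum_simplexProj_le (x : Fin n → ℝ) : ∑ k, simplexProj x k ≤ 1 := by
  simp only [simplexProj, ← Finset.sum_div]
  rw [div_le_one (by positivity)]
  exact le_max_right _ _

theorem simplexProj_le_one (x : Fin n → ℝ) (k : Fin n) : simplexProj x k ≤ 1 :=
  (Finset.single_le_sum (fun j _ => simplexProj_nonneg x j) (Finset.mem_univ k)).trans
    (sum_simplexProj_le x)

theorem simplexProj_eq {x : Fin n → ℝ} (h0 : ∀ k, 0 ≤ x k) (h1 : ∑ k, x k ≤ 1) :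
    simplexProj x = x := by
  funext k
  simp [simplexProj, h0, h1]

theorem continuous_simplexProj : Continuous (simplexProj (n := n)) := by
  refine continuous_pi fun k => ?_
  unfold simplexProj
  refine Continuous.div (by fun_prop) (by fun_prop) fun x => ?_
  positivity

theorem simplexProj_zero : simplexProj (0 : Fin n → ℝ) = 0 :=
  simplexProj_eq (fun _ => le_rfl) (by simp)

end Simplex

/-- Sub-convex combinations of affine minorants are affine minorants; the missing mass goes to the zero
minorant, which is allowed because `W` is nonnegative. -/
theorem IsAffineMinorant.sum_smul {W : Mat q d → ℝ} (hW : ∀ v, 0 ≤ W v) {n : ℕ}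
    {r : Fin n → Mat q d} {c : Fin n → ℝ} (hm : ∀ k, IsAffineMinorant W (r k) (c k))
    {x : Fin n → ℝ} (h0 : ∀ k, 0 ≤ x k) (h1 : ∑ k, x k ≤ 1) :
    IsAffineMinorant W (∑ k, x k • r k) (∑ k, x k * c k) := by
  intro v
  rw [sum_inner, ← Finset.sum_sub_distrib]
  calc ∑ k, (inner ℝ (x k • r k) v - x k * c k) = ∑ k, x k * (inner ℝ (r k) v - c k) := by
        refine Finset.sum_congr rfl fun k _ => ?_
        rw [real_inner_smul_left]; ring
    _ ≤ ∑ k, x k * W v := by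
        gcongr with k
        · exact h0 k
        · exact hm k v
    _ = (∑ k, x k) * W v := by rw [Finset.sum_mul]
    _ ≤ W v := mul_le_of_le_one_left (hW v) h1

section Core
variable {X : Type*} [MeasurableSpace X]

theorem tendsto_integral_sum_mul {σ : Measure X} {n : ℕ} {a : Fin n → X → ℝ}
    (ha : ∀ k, Integrable (a k) σ) {w : ℕ → X → Fin n → ℝ} {w₀ : X → Fin n → ℝ}
    (hwm : ∀ m k, AEStronglyMeasurable (fun z => w m z k) σ) (hw0 : ∀ m z k, 0 ≤ w m z k)
    (hw1 : ∀ m z k, w m z k ≤ 1)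
    (hw : ∀ᵐ z ∂σ, ∀ k, Tendsto (fun m => w m z k) atTop (nhds (w₀ z k))) :
    Tendsto (fun m => ∫ z, ∑ k, w m z k * a k z ∂σ) atTop
      (nhds (∫ z, ∑ k, w₀ z k * a k z ∂σ)) := by
  refine tendsto_integral_of_dominated_convergence (fun z => ∑ k, |a k z|) ?_ ?_ ?_ ?_
  · exact fun m => Finset.aestronglyMeasurable_fun_sum _ fun k _ =>
      (hwm m k).mul (ha k).aestronglyMeasurable
  · exact integrable_finsetSum _ fun k _ => (ha k).abs
  · refine fun m => Eventually.of_forall fun z => (Finset.abs_sum_le_sum_abs _ _).trans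
      (Finset.sum_le_sum fun k _ => ?_)
    rw [abs_mul, abs_of_nonneg (hw0 m z k)]
    exact mul_le_of_le_one_left (abs_nonneg _) (hw1 m z k)
  · filter_upwards [hw] with z hz
    exact tendsto_finsetSum _ fun k _ => (hz k).mul tendsto_const_nhds

variable [TopologicalSpace X] [R1Space X] [NormalSpace X] [WeaklyLocallyCompactSpace X]
  [BorelSpace X]

/-- Density of compactly supported continuous functions in `L¹`, in the form of an almost everywhere
convergent sequence. -/
theorem exists_seq_hasCompactSupport_tendsto_ae {E : Type*} [NormedAddCommGroup E]
    [NormedSpace ℝ E] {lam : Measure X} [lam.Regular] {f : X → E} (hf : Integrable f lam) :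
    ∃ g : ℕ → X → E, (∀ n, Continuous (g n)) ∧ (∀ n, HasCompactSupport (g n)) ∧
      ∀ᵐ x ∂lam, Tendsto (fun n => g n x) atTop (nhds (f x)) := by
  have h1 : ∀ n : ℕ, ∃ g : X → E, HasCompactSupport g ∧
      eLpNorm (f - g) 1 lam ≤ ((n : ℝ≥0∞) + 1)⁻¹ ∧ Continuous g ∧ MemLp g 1 lam := fun n =>
    (memLp_one_iff_integrable.2 hf).exists_hasCompactSupport_eLpNorm_sub_le ENNReal.one_ne_top
      (by simp)
  choose g hgs hgn hgc hgm using h1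
  have h2 : Tendsto (fun n => eLpNorm (g n - f) 1 lam) atTop (nhds 0) := by
    refine tendsto_of_tendsto_of_tendsto_of_le_of_le tendsto_const_nhds
      (h := fun n : ℕ => ((n : ℝ≥0∞) + 1)⁻¹) ?_ (fun _ => zero_le) fun n => ?_
    · have := ENNReal.tendsto_inv_nat_nhds_zero.comp (tendsto_add_atTop_nat 1)
      simpa [Function.comp_def] using this
    · rw [← eLpNorm_neg, neg_sub]
      exact hgn n
  obtain ⟨ns, -, hns⟩ := (tendstoInMeasure_of_tendsto_eLpNorm one_ne_zero
    (fun n => (hgm n).1) hf.1 h2).exists_seq_tendsto_ae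
  exact ⟨fun n => g (ns n), fun n => hgc _, fun n => hgs _, hns⟩

variable {W : Mat q d → ℝ} {μ ν : Measure X} [IsFiniteMeasure μ] [IsFiniteMeasure ν]
  {v h : X → Mat q d} {S : ℝ}

/-- The domination `∫ ψ · dJ ≤ ∫ g dμ + S`, assumed for continuous `ψ`, passes to measurable fields
`∑ χₖ rₖ` with values in the sub-convex hull of finitely many minorants. The weights `χ` are
approximated in `L¹(μ + ν)` by continuous functions, then retracted to the simplex so that the
constraint `W*(ψ) ≤ g` is kept. -/
theorem sum_integral_le_of_forall_continuous [(μ + ν).Regular] (hW : ∀ v, 0 ≤ W v)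
    (hv : Integrable v μ) (hh : Integrable h ν)
    (H : ∀ (ψ : X → Mat q d) (g : X → ℝ), Continuous ψ → HasCompactSupport ψ → Integrable g μ →
      (∀ z, IsAffineMinorant W (ψ z) (g z)) →
      ∫ z, inner ℝ (ψ z) (v z) ∂μ + ∫ z, inner ℝ (ψ z) (h z) ∂ν ≤ ∫ z, g z ∂μ + S)
    {n : ℕ} {r : Fin n → Mat q d} {c : Fin n → ℝ} (hm : ∀ k, IsAffineMinorant W (r k) (c k))
    {χ : X → Fin n → ℝ} (hχ : Measurable χ) (h0 : ∀ z k, 0 ≤ χ z k) (h1 : ∀ z, ∑ k, χ z k ≤ 1) :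
    ∫ z, ∑ k, χ z k * (inner ℝ (r k) (v z) - c k) ∂μ + ∫ z, ∑ k, χ z k * inner ℝ (r k) (h z) ∂ν
      ≤ S := by
  have hχ1 : ∀ z k, χ z k ≤ 1 := fun z k =>
    (Finset.single_le_sum (fun j _ => h0 z j) (Finset.mem_univ k)).trans (h1 z)
  have hχi : Integrable χ (μ + ν) := by
    refine Integrable.of_bound hχ.aestronglyMeasurable 1 (Eventually.of_forall fun z => ?_)
    rw [pi_norm_le_iff_of_nonneg zero_le_one]
    intro k
    rw [Real.norm_of_nonneg (h0 z k)]
    exact hχ1 z k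
  obtain ⟨f, hfc, hfs, hfa⟩ := exists_seq_hasCompactSupport_tendsto_ae hχi
  rw [ae_add_measure_iff] at hfa
  have hT : ∀ z, Tendsto (fun m => f m z) atTop (nhds (χ z)) →
      ∀ k, Tendsto (fun m => simplexProj (f m z) k) atTop (nhds (χ z k)) := by
    intro z hz k
    have := ((continuous_apply k).comp continuous_simplexProj).continuousAt.tendsto.comp hz
    simpa [simplexProj_eq (h0 z) (h1 z), Function.comp_def] using this
  have hcont : ∀ m k, Continuous fun z => simplexProj (f m z) k := fun m k =>
    (continuous_apply k).comp (continuous_simplexProj.comp (hfc m))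
  have hri : ∀ k, Integrable (fun z => inner ℝ (r k) (v z)) μ := fun k => hv.const_inner _
  have hrh : ∀ k, Integrable (fun z => inner ℝ (r k) (h z)) ν := fun k => hh.const_inner _
  have hfm : ∀ m k, Measurable fun z => simplexProj (f m z) k := fun m k => (hcont m k).measurable
  have L1 := tendsto_integral_sum_mul (fun k => (hri k).sub (integrable_const (c k)))
    (fun m k => (hfm m k).aestronglyMeasurable) (fun m z k => simplexProj_nonneg (f m z) k)
    (fun m z k => simplexProj_le_one (f m z) k) (hfa.1.mono hT)
  have L2 := tendsto_integral_sum_mul hrh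
    (fun m k => (hfm m k).aestronglyMeasurable) (fun m z k => simplexProj_nonneg (f m z) k)
    (fun m z k => simplexProj_le_one (f m z) k) (hfa.2.mono hT)
  refine le_of_tendsto' (L1.add L2) fun m => ?_
  have hb : ∀ k, Integrable (fun z => simplexProj (f m z) k) μ := fun k =>
    Integrable.of_bound (hcont m k).measurable.aestronglyMeasurable 1
      (Eventually.of_forall fun z => by
        rw [Real.norm_of_nonneg (simplexProj_nonneg _ _)]; exact simplexProj_le_one _ _)
  have hg : Integrable (fun z => ∑ k, simplexProj (f m z) k * c k) μ :=
    integrable_finsetSum _ fun k _ => (hb k).mul_const _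
  have key := H (fun z => ∑ k, simplexProj (f m z) k • r k)
    (fun z => ∑ k, simplexProj (f m z) k * c k)
    (continuous_finsetSum _ fun k _ => (hcont m k).smul continuous_const)
    ((hfs m).mono fun z hz => by
      contrapose! hz
      simp only [Function.mem_support, not_not] at hz
      simp [hz, simplexProj_zero]) hg
    (fun z => IsAffineMinorant.sum_smul hW hm (simplexProj_nonneg _) (sum_simplexProj_le _))
  simp only [sum_inner, real_inner_smul_left] at key
  have e1 : ∫ z, ∑ k, simplexProj (f m z) k * (inner ℝ (r k) (v z) - c k) ∂μ =
      ∫ z, ∑ k, simplexProj (f m z) k * inner ℝ (r k) (v z) ∂μ -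
        ∫ z, ∑ k, simplexProj (f m z) k * c k ∂μ := by
    rw [← integral_sub _ hg]
    · simp only [mul_sub, Finset.sum_sub_distrib]
    · refine integrable_finsetSum _ fun k _ => (hri k).bdd_mul (c := 1)
        (hcont m k).measurable.aestronglyMeasurable (Eventually.of_forall fun z => ?_)
      rw [Real.norm_of_nonneg (simplexProj_nonneg _ _)]; exact simplexProj_le_one _ _
  simp only [Pi.sub_apply]
  rw [e1]
  linarith

/-- The bound on the energy of `J = v μ + h ν`, with `μ ⟂ₘ ν`, from the domination of the linear form
`ψ ↦ ∫ ψ · dJ` by `∫ W*(ψ) dμ + S`. -/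
theorem lintegral_add_lintegral_recession_le [(μ + ν).Regular] (hW : ∀ v, 0 ≤ W v)
    (hWc : ConvexOn ℝ Set.univ W) (hμν : μ ⟂ₘ ν) (hvm : Measurable v) (hhm : Measurable h)
    (hv : Integrable v μ) (hh : Integrable h ν)
    (H : ∀ (ψ : X → Mat q d) (g : X → ℝ), Continuous ψ → HasCompactSupport ψ → Integrable g μ →
      (∀ z, IsAffineMinorant W (ψ z) (g z)) →
      ∫ z, inner ℝ (ψ z) (v z) ∂μ + ∫ z, inner ℝ (ψ z) (h z) ∂ν ≤ ∫ z, g z ∂μ + S) :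
    ∫⁻ z, ENNReal.ofReal (W (v z)) ∂μ + ∫⁻ z, recession W (h z) ∂ν ≤ ENNReal.ofReal S := by
  classical
  obtain ⟨r, c, hm, hr0, hc0, hs⟩ := exists_affineMinorant_seq hW hWc
  obtain ⟨N, hN, hμN, hνN⟩ := hμν
  -- The `k`-th minorant, read on the set `N` carrying `ν` as its recession `r k · h`.
  let a : ℕ → X → ℝ := fun k z => if z ∈ N then inner ℝ (r k) (h z) else inner ℝ (r k) (v z) - c k
  have ham : ∀ k, Measurable (a k) := fun k =>
    Measurable.ite hN (by fun_prop) (by fun_prop)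
  have haμ : ∀ᵐ z ∂μ, ∀ k, a k z = inner ℝ (r k) (v z) - c k := by
    filter_upwards [measure_eq_zero_iff_ae_notMem.1 hμN] with z hz k
    exact if_neg hz
  have haν : ∀ᵐ z ∂ν, ∀ k, a k z = inner ℝ (r k) (h z) := by
    filter_upwards [measure_eq_zero_iff_ae_notMem.1 hνN] with z hz k
    exact if_pos (by simpa using hz)
  have hai : ∀ k, Integrable (a k) (μ + ν) := fun k => by
    refine Integrable.add_measure ?_ ?_
    · exact ((hv.const_inner _).sub (integrable_const (c k))).congr
        (haμ.mono fun z hz => (hz k).symm)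
    · exact (hh.const_inner _).congr (haν.mono fun z hz => (hz k).symm)
  let M : ℕ → X → ℝ := fun n z =>
    (Finset.range (n + 1)).sup' Finset.nonempty_range_add_one fun k => a k z
  have hMm : ∀ n, Measurable (M n) := fun n =>
    Finset.measurable_range_sup'' fun k _ => ham k
  have hM0 : ∀ n z, 0 ≤ M n z := fun n z => by
    have : a 0 z = 0 := by simp [a, hr0, hc0]
    rw [← this]
    exact Finset.le_sup' (fun k => a k z) (by simp)
  have hex : ∀ n z, ∃ k, k < n + 1 ∧ a k z = M n z := fun n z => by
    obtain ⟨k, hk, hk'⟩ := Finset.exists_mem_eq_sup' (Finset.nonempty_range_add_one (n := n))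
      fun k => a k z
    exact ⟨k, Finset.mem_range.1 hk, hk'.symm⟩
  have hMS : ∀ n, Integrable (M n) (μ + ν) ∧ ∫ z, M n z ∂(μ + ν) ≤ S := by
    intro n
    -- The first index realising the maximum `M n`, a measurable function of the point.
    let κ : X → ℕ := fun z => Nat.find (hex n z)
    have hκm : Measurable κ := measurable_find _ fun k =>
      (MeasurableSet.const _).inter (measurableSet_eq_fun (ham k) (hMm n))
    have hκ : ∀ z, κ z < n + 1 ∧ a (κ z) z = M n z := fun z => Nat.find_spec (hex n z)
    let χ : X → Fin (n + 1) → ℝ := fun z k => if κ z = k then 1 else 0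
    have hχm : Measurable χ := measurable_pi_lambda _ fun k =>
      Measurable.ite (hκm (measurableSet_singleton _)) measurable_const measurable_const
    have hsum : ∀ z (b : ℕ → ℝ), ∑ k : Fin (n + 1), χ z k * b k = b (κ z) := by
      intro z b
      rw [Finset.sum_eq_single ⟨κ z, (hκ z).1⟩]
      · simp [χ]
      · intro k _ hk
        have : κ z ≠ k := fun h => hk (Fin.ext h.symm)
        simp [χ, this]
      · simp
    have hMeq : ∀ z, M n z = ∑ k : Fin (n + 1), χ z k * a k z := fun z => by
      rw [hsum z fun k => a k z, (hκ z).2]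
    have key := sum_integral_le_of_forall_continuous hW hv hh H
      (r := fun k : Fin (n + 1) => r k) (c := fun k : Fin (n + 1) => c k) (fun k => hm k) hχm
      (fun z k => by simp only [χ]; split_ifs <;> norm_num)
      (fun z => by have := hsum z fun _ => 1; simp only [mul_one] at this; exact this.le)
    have hi : Integrable (M n) (μ + ν) := by
      refine Integrable.congr ?_ (Eventually.of_forall fun z => (hMeq z).symm)
      refine integrable_finsetSum _ fun k _ => (hai k).bdd_mul (c := 1)
        ((measurable_pi_apply k).comp hχm).aestronglyMeasurable (Eventually.of_forall fun z => ?_)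
      simp only [χ]; split_ifs <;> norm_num
    refine ⟨hi, ?_⟩
    rw [integral_add_measure hi.left_of_add_measure hi.right_of_add_measure]
    refine le_of_eq_of_le ?_ key
    congr 1
    · refine integral_congr_ae (haμ.mono fun z hz => ?_)
      simp only [hMeq, hz]
    · refine integral_congr_ae (haν.mono fun z hz => ?_)
      simp only [hMeq, hz]
  have hF : ∫⁻ z, ⨆ n, ENNReal.ofReal (M n z) ∂(μ + ν) ≤ ENNReal.ofReal S := by
    rw [lintegral_iSup (fun n => (hMm n).ennreal_ofReal)]
    · refine iSup_le fun n => ?_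
      rw [← ofReal_integral_eq_lintegral_ofReal (hMS n).1 (Eventually.of_forall (hM0 n))]
      exact ENNReal.ofReal_le_ofReal (hMS n).2
    · intro m n hmn z
      refine ENNReal.ofReal_le_ofReal (Finset.sup'_mono _ ?_ _)
      exact Finset.range_mono (by omega)
  have hle : ∀ k z, ENNReal.ofReal (a k z) ≤ ⨆ n, ENNReal.ofReal (M n z) := fun k z =>
    (ENNReal.ofReal_le_ofReal (Finset.le_sup' (fun k => a k z)
      (Finset.mem_range.2 (Nat.lt_succ_self k)))).trans (le_iSup (fun n => ENNReal.ofReal (M n z)) k)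
  refine le_trans ?_ hF
  rw [lintegral_add_measure]
  refine add_le_add (lintegral_mono_ae (haμ.mono fun z hz => ?_))
    (lintegral_mono_ae (haν.mono fun z hz => ?_))
  · refine le_of_forall_lt fun b hb => ?_
    have hb' : b.toReal < W (v z) := (ENNReal.lt_ofReal_iff_toReal_lt hb.ne_top).1 hb
    obtain ⟨k, hk⟩ := hs (v z) _ hb'
    rw [← hz k] at hk
    exact ((ENNReal.lt_ofReal_iff_toReal_lt hb.ne_top).2 hk).trans_le (hle k z)
  · refine (recession_le_iSup hm hs (h z)).trans (iSup_le fun k => ?_)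
    rw [← hz k]
    exact hle k z

end Core

/-! ### Decomposition of matrix-valued measures -/

section MatrixMeasures
variable {X : Type*} [MeasurableSpace X]

@[simp]
theorem entry_apply (J : VectorMeasure X (Mat q d)) (ij : Fin q × Fin d) (A : Set X) :
    entry J ij A = J A ij := rfl

theorem entry_sub (J K : VectorMeasure X (Mat q d)) (ij : Fin q × Fin d) :
    entry (J - K) ij = entry J ij - entry K ij := by
  ext A _
  simp

theorem measurable_density (J : VectorMeasure X (Mat q d)) (μ : Measure X) :
    Measurable (density J μ) :=
  (WithLp.measurable_toLp 2 _).comp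
    (measurable_pi_lambda _ fun _ => SignedMeasure.measurable_rnDeriv _ _)

theorem integrable_density (J : VectorMeasure X (Mat q d)) (μ : Measure X) :
    Integrable (density J μ) μ :=
  Integrable.of_eval_piLp fun _ => SignedMeasure.integrable_rnDeriv _ μ

theorem entry_withDensityᵥ {μ : Measure X} {f : X → Mat q d} (hf : Integrable f μ)
    (ij : Fin q × Fin d) :
    entry (μ.withDensityᵥ f) ij = μ.withDensityᵥ fun z => f z ij := by
  ext A hA
  have hf' : ∀ ij, Integrable (fun z => f z ij) μ := fun ij => hf.eval_piLp ij
  rw [entry_apply, withDensityᵥ_apply hf hA, withDensityᵥ_apply (hf' ij) hA]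
  exact eval_integral_piLp (fun i => (hf' i).integrableOn) ij

theorem entry_singPart (J : VectorMeasure X (Mat q d)) (μ : Measure X) [IsFiniteMeasure μ]
    (ij : Fin q × Fin d) : entry (singPart J μ) ij = (entry J ij).singularPart μ := by
  rw [singPart, entry_sub, entry_withDensityᵥ (integrable_density J μ), sub_eq_iff_eq_add]
  exact (SignedMeasure.singularPart_add_withDensity_rnDeriv_eq _ _).symm

theorem variation_le_sum_entry (J : VectorMeasure X (Mat q d)) :
    J.variation ≤ ∑ ij, (entry J ij).variation := by
  refine VectorMeasure.variation_le_of_forall_enorm_le fun A hA => ?_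
  rw [Measure.finsetSum_apply]
  calc ‖J A‖ₑ = ‖∑ ij, EuclideanSpace.single ij (J A ij)‖ₑ := by
        congr 1
        ext ij
        simp [Finset.sum_apply]
    _ ≤ ∑ ij, ‖EuclideanSpace.single ij (J A ij)‖ₑ := enorm_sum_le _ _
    _ ≤ ∑ ij, (entry J ij).variation A := by
        refine Finset.sum_le_sum fun ij _ => ?_
        have : ‖EuclideanSpace.single ij (J A ij)‖ₑ = ‖J A ij‖ₑ := by
          simp [enorm_eq_nnnorm]
        rw [this]
        exact VectorMeasure.enorm_measure_le_variation (entry J ij) A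

instance isFiniteMeasure_variation_signed (s : SignedMeasure X) : IsFiniteMeasure s.variation := by
  rw [← SignedMeasure.totalVariation_eq_variation, SignedMeasure.totalVariation]
  infer_instance

instance isFiniteMeasure_variation (J : VectorMeasure X (Mat q d)) :
    IsFiniteMeasure J.variation :=
  isFiniteMeasure_of_le _ (variation_le_sum_entry J)

theorem variation_singPart_mutuallySingular (J : VectorMeasure X (Mat q d)) (μ : Measure X)
    [IsFiniteMeasure μ] : (singPart J μ).variation ⟂ₘ μ := by
  have h : (∑ ij, (entry (singPart J μ) ij).variation) ⟂ₘ μ := by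
    rw [← Measure.sum_fintype, Measure.MutuallySingular.sum_left]
    intro ij
    rw [entry_singPart, ← SignedMeasure.totalVariation_eq_variation,
      SignedMeasure.singularPart_totalVariation]
    exact (Measure.mutuallySingular_singularPart _ _).add_left
      (Measure.mutuallySingular_singularPart _ _)
  exact h.mono (variation_le_sum_entry _) le_rfl

theorem withDensityᵥ_density_variation (J : VectorMeasure X (Mat q d)) (ij : Fin q × Fin d) :
    J.variation.withDensityᵥ (fun z => density J J.variation z ij) = entry J ij := by
  refine SignedMeasure.withDensityᵥ_rnDeriv_eq _ _ (VectorMeasure.AbsolutelyContinuous.mk ?_)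
  intro A hA h
  rw [Measure.toENNRealVectorMeasure_apply_measurable hA] at h
  have h1 := VectorMeasure.enorm_measure_le_variation J A
  rw [h, nonpos_iff_eq_zero, enorm_eq_zero] at h1
  rw [entry_apply, h1]
  rfl

/-- For real-valued integrands the pairings `lsmul` and `lsmul.flip` coincide. -/
theorem integral_vectorMeasure_toSignedMeasure (μ : Measure X) [IsFiniteMeasure μ] (f : X → ℝ) :
    ∫ᵛ z, f z ∂•μ.toSignedMeasure = ∫ z, f z ∂μ := by
  rw [← VectorMeasure.integral_toSignedMeasure]
  congr 1
  ext
  simp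

theorem integral_vectorMeasure_withDensityᵥ {μ : Measure X} {k f : X → ℝ}
    (hk : Integrable k μ) (hkm : Measurable k) (hf : Measurable f) {C : ℝ} (hC : ∀ z, |f z| ≤ C) :
    ∫ᵛ z, f z ∂•(μ.withDensityᵥ k) = ∫ z, f z * k z ∂μ := by
  have hfk : ∀ k', Integrable k' μ → Integrable (fun z => f z * k' z) μ := fun k' hk' =>
    hk'.bdd_mul (c := C) hf.aestronglyMeasurable (Eventually.of_forall hC)
  have := isFiniteMeasure_withDensity_ofReal hk.2
  have := isFiniteMeasure_withDensity_ofReal hk.neg.2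
  have hi : ∀ (σ : Measure X) [IsFiniteMeasure σ], σ.toSignedMeasure.Integrable f := by
    intro σ _
    rw [VectorMeasure.Integrable, Measure.variation_toSignedMeasure]
    exact Integrable.of_bound hf.aestronglyMeasurable C (Eventually.of_forall hC)
  rw [withDensityᵥ_eq_withDensity_pos_part_sub_withDensity_neg_part hk,
    VectorMeasure.integral_sub_vectorMeasure (hi _) (hi _),
    integral_vectorMeasure_toSignedMeasure, integral_vectorMeasure_toSignedMeasure,
    integral_withDensity_eq_integral_toReal_smul (by fun_prop) (by simp),
    integral_withDensity_eq_integral_toReal_smul (by fun_prop) (by simp), ← integral_sub]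
  · refine integral_congr_ae (Eventually.of_forall fun z => ?_)
    simp only [ENNReal.toReal_ofReal', smul_eq_mul]
    rw [← sub_mul, mul_comm]
    congr 1
    rcases le_total 0 (k z) with h | h
    · rw [max_eq_left h, max_eq_right (by linarith)]; ring
    · rw [max_eq_right h, max_eq_left (by linarith)]; ring
  · refine (hfk _ hk.pos_part).congr (Eventually.of_forall fun z => ?_)
    simp only [ENNReal.toReal_ofReal', smul_eq_mul]
    ring
  · refine (hfk _ hk.neg_part).congr (Eventually.of_forall fun z => ?_)
    simp only [ENNReal.toReal_ofReal', smul_eq_mul]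
    ring

/-- Integration against an entry of `J`, computed from the decomposition `J = v μ + h |J^⊥|`. -/
theorem integral_entry_eq (J : VectorMeasure X (Mat q d)) (μ : Measure X) [IsFiniteMeasure μ]
    (ij : Fin q × Fin d) {f : X → ℝ} (hf : Measurable f) {C : ℝ} (hC : ∀ z, |f z| ≤ C) :
    ∫ᵛ z, f z ∂•(entry J ij) = ∫ z, f z * density J μ z ij ∂μ +
      ∫ z, f z * density (singPart J μ) (singPart J μ).variation z ij
        ∂(singPart J μ).variation := by
  have hd : entry J ij = μ.withDensityᵥ (fun z => density J μ z ij) +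
      (singPart J μ).variation.withDensityᵥ
        (fun z => density (singPart J μ) (singPart J μ).variation z ij) := by
    rw [withDensityᵥ_density_variation, entry_singPart, add_comm]
    exact (SignedMeasure.singularPart_add_withDensity_rnDeriv_eq _ _).symm
  have hi : ∀ s : SignedMeasure X, s.Integrable f := fun s =>
    Integrable.of_bound hf.aestronglyMeasurable C (Eventually.of_forall hC)
  rw [hd, VectorMeasure.integral_add_vectorMeasure (hi _) (hi _),
    integral_vectorMeasure_withDensityᵥ _ _ hf hC, integral_vectorMeasure_withDensityᵥ _ _ hf hC]
  · exact (integrable_density _ _).eval_piLp ij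
  · exact SignedMeasure.measurable_rnDeriv _ _
  · exact (integrable_density _ _).eval_piLp ij
  · exact SignedMeasure.measurable_rnDeriv _ _

/-- The pairing `∫ ψ · dJ` of a bounded field with a matrix-valued measure, computed from the
decomposition `J = v μ + h |J^⊥|`. -/
theorem sum_integral_entry_eq (J : VectorMeasure X (Mat q d)) (μ : Measure X) [IsFiniteMeasure μ]
    {ψ : X → Mat q d} (hψ : Measurable ψ) {C : ℝ} (hC : ∀ z, ‖ψ z‖ ≤ C) :
    ∑ ij, ∫ᵛ z, ψ z ij ∂•(entry J ij) = ∫ z, inner ℝ (ψ z) (density J μ z) ∂μ +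
      ∫ z, inner ℝ (ψ z) (density (singPart J μ) (singPart J μ).variation z)
        ∂(singPart J μ).variation := by
  have hm : ∀ ij, Measurable fun z => ψ z ij := fun ij =>
    (EuclideanSpace.proj (𝕜 := ℝ) ij : Mat q d →L[ℝ] ℝ).continuous.measurable.comp hψ
  have hb : ∀ ij z, |ψ z ij| ≤ C := fun ij z => (PiLp.norm_apply_le (ψ z) ij).trans (hC z)
  have hint : ∀ (σ : Measure X) (k : X → Mat q d), Integrable k σ →
      ∑ ij, ∫ z, ψ z ij * k z ij ∂σ = ∫ z, inner ℝ (ψ z) (k z) ∂σ := by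
    intro σ k hk
    rw [← integral_finsetSum]
    · refine integral_congr_ae (Eventually.of_forall fun z => ?_)
      simp [PiLp.inner_apply, mul_comm]
    · exact fun ij _ => (hk.eval_piLp ij).bdd_mul (c := C) (hm ij).aestronglyMeasurable
        (Eventually.of_forall (hb ij))
  simp only [integral_entry_eq J μ _ (hm _) (hb _)]
  rw [Finset.sum_add_distrib, hint _ _ (integrable_density _ _), hint _ _ (integrable_density _ _)]

/-- The matrix-valued measure with prescribed entries. -/
def ofEntries (s : Fin q × Fin d → SignedMeasure X) : VectorMeasure X (Mat q d) :=
  ∑ ij, (s ij).mapRange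
    (ContinuousLinearMap.toSpanSingleton ℝ
      (EuclideanSpace.single ij 1 : Mat q d)).toLinearMap.toAddMonoidHom
    (ContinuousLinearMap.toSpanSingleton ℝ (EuclideanSpace.single ij 1 : Mat q d)).continuous

theorem entry_ofEntries (s : Fin q × Fin d → SignedMeasure X) (ij : Fin q × Fin d) :
    entry (ofEntries s) ij = s ij := by
  ext A _
  rw [entry_apply, ofEntries]
  have : ∀ (t : Finset (Fin q × Fin d)) (F : Fin q × Fin d → VectorMeasure X (Mat q d)),
      (∑ i ∈ t, F i) A = ∑ i ∈ t, F i A := by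
    classical
    intro t F
    induction t using Finset.induction_on with
    | empty => simp
    | insert a t ha ih => simp [Finset.sum_insert ha, ih]
  rw [this]
  simp [Pi.single_apply]

end MatrixMeasures

/-! ### Bounded linear forms on compactly supported functions -/

section Riesz
variable {X : Type*} [TopologicalSpace X]

/-- A linear form with `Λ f ≤ C ‖f‖_∞` is a difference of two positive ones. The form
`(f, -f, a) ↦ Λ f + C a` is nonnegative where `f + a ≥ 0` and `-f + a ≥ 0`; a positive extension of it
to all triples `(f, g, a)` restricts to the two positive forms on the first two factors. -/
theorem exists_nonneg_sub_of_bounded (Λ : C_c(X, ℝ) →ₗ[ℝ] ℝ) (C : ℝ)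
    (hΛ : ∀ f M, 0 ≤ M → (∀ x, |f x| ≤ M) → Λ f ≤ C * M) :
    ∃ P₁ P₂ : C_c(X, ℝ) →ₗ[ℝ] ℝ, (∀ f, Λ f = P₁ f - P₂ f) ∧
      (∀ f, 0 ≤ f → 0 ≤ P₁ f) ∧ (∀ f, 0 ≤ f → 0 ≤ P₂ f) ∧
      (∀ f M, 0 ≤ M → (∀ x, f x ≤ M) → P₁ f ≤ C * M) ∧
      (∀ f M, 0 ≤ M → (∀ x, f x ≤ M) → P₂ f ≤ C * M) := by
  -- The cone of triples `(f, g, a)` with `a ≥ 0`, `f + a ≥ 0` and `g + a ≥ 0`.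
  let K : PointedCone ℝ (C_c(X, ℝ) × C_c(X, ℝ) × ℝ) :=
    { carrier := {F | 0 ≤ F.2.2 ∧ ∀ x, 0 ≤ F.1 x + F.2.2 ∧ 0 ≤ F.2.1 x + F.2.2}
      add_mem' := by
        rintro a b ⟨ha0, ha⟩ ⟨hb0, hb⟩
        refine ⟨add_nonneg ha0 hb0, fun x => ⟨?_, ?_⟩⟩
        · have := add_nonneg (ha x).1 (hb x).1
          simp only [Prod.fst_add, Prod.snd_add, CompactlySupportedContinuousMap.add_apply]
          linarith
        · have := add_nonneg (ha x).2 (hb x).2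
          simp only [Prod.fst_add, Prod.snd_add, CompactlySupportedContinuousMap.add_apply]
          linarith
      zero_mem' := by simp
      smul_mem' := by
        rintro ⟨t, ht⟩ a ⟨ha0, ha⟩
        refine ⟨mul_nonneg ht ha0, fun x => ⟨?_, ?_⟩⟩
        · have := mul_nonneg ht (ha x).1
          rw [mul_add] at this
          exact this
        · have := mul_nonneg ht (ha x).2
          rw [mul_add] at this
          exact this }
  let dom : Submodule ℝ (C_c(X, ℝ) × C_c(X, ℝ) × ℝ) :=
    { carrier := {F | F.2.1 = -F.1}
      add_mem' := by
        intro a b ha hb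
        simp only [Set.mem_ofPred_eq] at ha hb
        simp only [Set.mem_ofPred_eq, Prod.fst_add, Prod.snd_add, ha, hb]
        abel
      zero_mem' := by simp
      smul_mem' := by
        intro t a ha
        simp only [Set.mem_ofPred_eq] at ha
        simp only [Set.mem_ofPred_eq, Prod.smul_fst, Prod.smul_snd, ha]
        ext x
        simp }
  let f0 : (C_c(X, ℝ) × C_c(X, ℝ) × ℝ) →ₗ[ℝ] ℝ := Λ.comp (LinearMap.fst ℝ _ _) +
    C • (LinearMap.snd ℝ C_c(X, ℝ) ℝ).comp (LinearMap.snd ℝ _ _)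
  have hf0 : ∀ F : (C_c(X, ℝ) × C_c(X, ℝ) × ℝ), f0 F = Λ F.1 + C * F.2.2 := fun F => rfl
  obtain ⟨G, hG, hGK⟩ := riesz_extension K ⟨dom, f0.comp dom.subtype⟩ (by
      rintro ⟨F, hF⟩ ⟨h0, hx⟩
      change 0 ≤ f0 F
      have hF' : F.2.1 = -F.1 := hF
      rw [hf0]
      have := hΛ (-F.1) F.2.2 h0 (fun x => by
        have h1 := (hx x).1
        have h2 := (hx x).2
        rw [hF'] at h2
        simp only [CompactlySupportedContinuousMap.neg_apply] at h2 ⊢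
        rw [abs_le]; constructor <;> linarith)
      rw [map_neg] at this
      linarith) (by
      rintro ⟨f, g, a⟩
      obtain ⟨A, hA⟩ : ∃ A, ∀ x, ‖f x‖ ≤ A :=
        f.hasCompactSupport.exists_bound_of_continuous f.continuous
      obtain ⟨B, hB⟩ : ∃ B, ∀ x, ‖g x‖ ≤ B :=
        g.hasCompactSupport.exists_bound_of_continuous g.continuous
      refine ⟨⟨(0, 0, |A| + |B| - a), by simp [dom]⟩, ?_, ?_⟩
      · simp only [Prod.snd_add]
        linarith [abs_nonneg A, abs_nonneg B]
      · intro x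
        have h1 := neg_le_of_abs_le ((hA x).trans (le_abs_self A))
        have h2 := neg_le_of_abs_le ((hB x).trans (le_abs_self B))
        simp only [Prod.fst_add, Prod.snd_add, zero_add]
        constructor <;> linarith [abs_nonneg A, abs_nonneg B])
  have hGd : ∀ f a, G (f, -f, a) = Λ f + C * a := fun f a => hG ⟨(f, -f, a), rfl⟩
  have hG1 : ∀ a, G (0, 0, a) = C * a := fun a => by simpa using hGd 0 a
  refine ⟨G.comp (LinearMap.inl ℝ _ _), G.comp ((LinearMap.inr ℝ _ _).comp (LinearMap.inl ℝ _ _)),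
    ?_, ?_, ?_, ?_, ?_⟩
  · intro f
    have h1 := hGd f 0
    simp only [LinearMap.comp_apply, LinearMap.inl_apply, LinearMap.inr_apply]
    rw [← map_sub]
    simp only [mul_zero, add_zero] at h1
    rw [← h1]
    congr 1
    ext <;> simp
  · intro f hf
    exact hGK _ ⟨le_rfl, fun x => ⟨by simpa using hf x, by simp⟩⟩
  · intro f hf
    exact hGK _ ⟨le_rfl, fun x => ⟨by simp, by simpa using hf x⟩⟩
  · intro f M hM hf
    have h1 : 0 ≤ G (-f, 0, M) := hGK _ ⟨hM, fun x => ⟨by simpa using hf x, by simpa using hM⟩⟩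
    have h2 : ((-f, 0, M) : (C_c(X, ℝ) × C_c(X, ℝ) × ℝ)) = (0, 0, M) - (f, 0, 0) := by ext <;> simp
    rw [h2, map_sub, hG1] at h1
    simp only [LinearMap.comp_apply, LinearMap.inl_apply]
    have : G (f, 0, 0) = G (f, 0) := rfl
    linarith
  · intro f M hM hf
    have h1 : 0 ≤ G (0, -f, M) := hGK _ ⟨hM, fun x => ⟨by simpa using hM, by simpa using hf x⟩⟩
    have h2 : ((0, -f, M) : (C_c(X, ℝ) × C_c(X, ℝ) × ℝ)) = (0, 0, M) - (0, f, 0) := by ext <;> simp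
    rw [h2, map_sub, hG1] at h1
    simp only [LinearMap.comp_apply, LinearMap.inl_apply, LinearMap.inr_apply]
    linarith

variable [T2Space X] [LocallyCompactSpace X] [SigmaCompactSpace X] [MeasurableSpace X]
  [BorelSpace X]

theorem exists_finiteMeasure_of_nonneg_of_bounded (P : C_c(X, ℝ) →ₗ[ℝ] ℝ)
    (hP : ∀ f, 0 ≤ f → 0 ≤ P f) (C : ℝ) (hb : ∀ f : C_c(X, ℝ), (∀ x, f x ≤ 1) → P f ≤ C) :
    ∃ ν : Measure X, IsFiniteMeasure ν ∧ ∀ f, P f = ∫ x, f x ∂ν := by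
  let Λ : C_c(X, ℝ) →ₚ[ℝ] ℝ := PositiveLinearMap.mk₀ P hP
  refine ⟨RealRMK.rieszMeasure Λ, ⟨?_⟩, fun f => (RealRMK.integral_rieszMeasure Λ f).symm⟩
  have h1 : ∀ K : Set X, IsCompact K → RealRMK.rieszMeasure Λ K ≤ ENNReal.ofReal C := by
    intro K hK
    obtain ⟨f, hf1, hf2, -, hf3⟩ :=
      exists_continuousMap_one_of_isCompact_subset_isOpen hK isOpen_univ (Set.subset_univ K)
    refine (RealRMK.rieszMeasure_le_of_eq_one Λ (f := ⟨f, hf2⟩) (fun x => (hf3 x).1) hK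
      (fun x hx => hf1 hx)).trans (ENNReal.ofReal_le_ofReal ?_)
    exact hb _ fun x => (hf3 x).2
  refine lt_of_le_of_lt ?_ (ENNReal.ofReal_lt_top (r := C))
  have hmono : Monotone (compactCovering X) := fun _ _ h => compactCovering_subset X h
  rw [← iUnion_compactCovering X, hmono.measure_iUnion]
  exact iSup_le fun n => h1 _ (isCompact_compactCovering X n)

/-- Riesz representation of bounded linear forms on `C_c(X, ℝ)` by differences of finite measures. -/
theorem exists_measure_sub_of_bounded (Λ : C_c(X, ℝ) →ₗ[ℝ] ℝ) (C : ℝ)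
    (hΛ : ∀ f M, 0 ≤ M → (∀ x, |f x| ≤ M) → Λ f ≤ C * M) :
    ∃ ν₁ ν₂ : Measure X, IsFiniteMeasure ν₁ ∧ IsFiniteMeasure ν₂ ∧
      ∀ f, Λ f = ∫ x, f x ∂ν₁ - ∫ x, f x ∂ν₂ := by
  obtain ⟨P₁, P₂, h, hp₁, hp₂, hb₁, hb₂⟩ := exists_nonneg_sub_of_bounded Λ C hΛ
  obtain ⟨ν₁, hν₁, h₁⟩ := exists_finiteMeasure_of_nonneg_of_bounded P₁ hp₁ C
    fun f hf => by simpa using hb₁ f 1 zero_le_one hf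
  obtain ⟨ν₂, hν₂, h₂⟩ := exists_finiteMeasure_of_nonneg_of_bounded P₂ hp₂ C
    fun f hf => by simpa using hb₂ f 1 zero_le_one hf
  exact ⟨ν₁, ν₂, hν₁, hν₂, fun f => by rw [h, h₁, h₂]⟩
end Riesz

/-! ### Test functions -/

section Tests
variable {Ω : Set (Euc d)}

theorem IsTest.mono {m n : ℕ∞} {φ : Euc d × Euc q → Euc d} (h : IsTest n Ω φ) (hmn : m ≤ n) :
    IsTest m Ω φ :=
  ⟨h.contDiff.of_le (by exact_mod_cast hmn), h.hasCompactSupport, h.tsupport_subset⟩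

theorem gradY_add {φ ψ : Euc d × Euc q → Euc d} {z : Euc d × Euc q}
    (hφ : DifferentiableAt ℝ φ z) (hψ : DifferentiableAt ℝ ψ z) :
    gradY (φ + ψ) z = gradY φ z + gradY ψ z := by
  ext ij
  simp [gradY, fderiv_add hφ hψ]

theorem gradY_smul (c : ℝ) (φ : Euc d × Euc q → Euc d) (z : Euc d × Euc q) :
    gradY (c • φ) z = c • gradY φ z := by
  ext ij
  simp [gradY, fderiv_const_smul_field]

theorem divX_add {φ ψ : Euc d × Euc q → Euc d} {z : Euc d × Euc q}
    (hφ : DifferentiableAt ℝ φ z) (hψ : DifferentiableAt ℝ ψ z) :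
    divX (φ + ψ) z = divX φ z + divX ψ z := by
  simp [divX, fderiv_add hφ hψ, Finset.sum_add_distrib]

theorem divX_smul (c : ℝ) (φ : Euc d × Euc q → Euc d) (z : Euc d × Euc q) :
    divX (c • φ) z = c * divX φ z := by
  simp [divX, fderiv_const_smul_field, Finset.mul_sum]

theorem IsTest.differentiable {φ : Euc d × Euc q → Euc d} (h : IsTest 1 Ω φ) :
    Differentiable ℝ φ := h.contDiff.differentiable (by simp)

theorem IsTest.continuous_fderiv {φ : Euc d × Euc q → Euc d} (h : IsTest 1 Ω φ) :
    Continuous (fderiv ℝ φ) := h.contDiff.continuous_fderiv (by simp)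

theorem IsTest.continuous_gradY {φ : Euc d × Euc q → Euc d} (h : IsTest 1 Ω φ) :
    Continuous (gradY φ) := by
  refine (PiLp.continuous_toLp 2 _).comp (continuous_pi fun ij => ?_)
  exact (EuclideanSpace.proj (𝕜 := ℝ) ij.2).continuous.comp
    (h.continuous_fderiv.clm_apply continuous_const)

theorem IsTest.continuous_divX {φ : Euc d × Euc q → Euc d} (h : IsTest 1 Ω φ) :
    Continuous (divX φ) := by
  refine continuous_finsetSum _ fun j _ => ?_
  exact (EuclideanSpace.proj (𝕜 := ℝ) j).continuous.comp
    (h.continuous_fderiv.clm_apply continuous_const)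

theorem tsupport_gradY_subset (φ : Euc d × Euc q → Euc d) : tsupport (gradY φ) ⊆ tsupport φ := by
  refine (closure_mono fun z hz => ?_).trans (tsupport_fderiv_subset ℝ (f := φ))
  contrapose! hz
  simp only [Function.mem_support, not_not] at hz
  simp only [Function.mem_support, not_not, gradY, hz]
  ext
  simp

theorem tsupport_divX_subset (φ : Euc d × Euc q → Euc d) : tsupport (divX φ) ⊆ tsupport φ := by
  refine (closure_mono fun z hz => ?_).trans (tsupport_fderiv_subset ℝ (f := φ))
  contrapose! hz
  simp only [Function.mem_support, not_not] at hz
  simp [divX, hz]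

theorem hasCompactSupport_comp_coe {F : Type*} [Zero F] {f : Euc d × Euc q → F}
    (hf : HasCompactSupport f) (hs : tsupport f ⊆ Ω ×ˢ Set.univ) :
    HasCompactSupport fun z : Ω × Euc q => f ((z.1 : Euc d), z.2) := by
  have he : Topology.IsEmbedding (Prod.map ((↑) : Ω → Euc d) (id : Euc q → Euc q)) :=
    Topology.IsEmbedding.subtypeVal.prodMap Topology.IsEmbedding.id
  refine HasCompactSupport.intro (K := Prod.map ((↑) : Ω → Euc d) (id : Euc q → Euc q) ⁻¹' tsupport f)
    (he.isInducing.isCompact_preimage' hf ?_) fun z hz => image_eq_zero_of_notMem_tsupport hz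
  simpa [Set.range_prodMap] using hs

theorem IsTest.hasCompactSupport_gradY {φ : Euc d × Euc q → Euc d} (h : IsTest 1 Ω φ) :
    HasCompactSupport fun z : Ω × Euc q => gradY φ ((z.1 : Euc d), z.2) :=
  hasCompactSupport_comp_coe
    (h.hasCompactSupport.of_isClosed_subset (isClosed_tsupport _) (tsupport_gradY_subset φ))
    ((tsupport_gradY_subset φ).trans h.tsupport_subset)

theorem IsTest.hasCompactSupport_divX {φ : Euc d × Euc q → Euc d} (h : IsTest 1 Ω φ) :
    HasCompactSupport fun z : Ω × Euc q => divX φ ((z.1 : Euc d), z.2) :=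
  hasCompactSupport_comp_coe
    (h.hasCompactSupport.of_isClosed_subset (isClosed_tsupport _) (tsupport_divX_subset φ))
    ((tsupport_divX_subset φ).trans h.tsupport_subset)

theorem IsTest.continuous_gradY_coe {φ : Euc d × Euc q → Euc d} (h : IsTest 1 Ω φ) :
    Continuous fun z : Ω × Euc q => gradY φ ((z.1 : Euc d), z.2) :=
  h.continuous_gradY.comp (by fun_prop)

theorem IsTest.continuous_divX_coe {φ : Euc d × Euc q → Euc d} (h : IsTest 1 Ω φ) :
    Continuous fun z : Ω × Euc q => divX φ ((z.1 : Euc d), z.2) :=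
  h.continuous_divX.comp (by fun_prop)

theorem IsTest.integrable_divX {φ : Euc d × Euc q → Euc d} (h : IsTest 1 Ω φ)
    (μ : Measure (Ω × Euc q)) [IsFiniteMeasure μ] :
    Integrable (fun z : Ω × Euc q => divX φ ((z.1 : Euc d), z.2)) μ :=
  h.continuous_divX_coe.integrable_of_hasCompactSupport h.hasCompactSupport_divX

theorem isTest_zero (n : ℕ∞) : IsTest n Ω (0 : Euc d × Euc q → Euc d) :=
  ⟨contDiff_const, HasCompactSupport.zero, by simp⟩

theorem IsTest.add {φ ψ : Euc d × Euc q → Euc d} {n : ℕ∞} (hφ : IsTest n Ω φ)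
    (hψ : IsTest n Ω ψ) : IsTest n Ω (φ + ψ) :=
  ⟨hφ.contDiff.add hψ.contDiff, hφ.hasCompactSupport.add hψ.hasCompactSupport,
    (tsupport_add φ ψ).trans (Set.union_subset hφ.tsupport_subset hψ.tsupport_subset)⟩

theorem IsTest.const_smul {φ : Euc d × Euc q → Euc d} {n : ℕ∞} (hφ : IsTest n Ω φ) (c : ℝ) :
    IsTest n Ω (c • φ) := by
  have : tsupport (c • φ) ⊆ tsupport φ := tsupport_smul_subset_right (fun _ => c) φ
  exact ⟨contDiff_const.smul hφ.contDiff,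
    hφ.hasCompactSupport.of_isClosed_subset (isClosed_tsupport _) this,
    this.trans hφ.tsupport_subset⟩

variable (Ω) in
/-- The space `C¹_c(Ω × ℝ^q, ℝ^d)`, as a subspace of functions on `ℝ^d × ℝ^q`. -/
def testSpace : Submodule ℝ (Euc d × Euc q → Euc d) where
  carrier := {φ | IsTest 1 Ω φ}
  add_mem' := IsTest.add
  zero_mem' := isTest_zero 1
  smul_mem' c _ h := h.const_smul c

/-- The linear map `φ ↦ ∇_y φ` on `C¹_c(Ω × ℝ^q, ℝ^d)`, with the entries of `∇_y φ` as values. -/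
def gradMap : testSpace (q := q) Ω →ₗ[ℝ] (Fin q × Fin d → C_c(Ω × Euc q, ℝ)) where
  toFun φ ij :=
    ⟨⟨fun z => gradY φ.1 ((z.1 : Euc d), z.2) ij,
      (EuclideanSpace.proj (𝕜 := ℝ) ij).continuous.comp (IsTest.continuous_gradY_coe φ.2)⟩,
      (IsTest.hasCompactSupport_gradY φ.2).comp_left (g := fun r : Mat q d => r ij) rfl⟩
  map_add' φ ψ := by
    ext ij z
    exact congrArg (fun r : Mat q d => r ij)
      (gradY_add (IsTest.differentiable φ.2 _) (IsTest.differentiable ψ.2 _))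
  map_smul' c φ := by
    ext ij z
    exact congrArg (fun r : Mat q d => r ij) (gradY_smul c φ.1 _)

@[simp]
theorem gradMap_apply (φ : testSpace (q := q) Ω) (ij : Fin q × Fin d) (z : Ω × Euc q) :
    gradMap φ ij z = gradY φ.1 ((z.1 : Euc d), z.2) ij := rfl

/-- The linear form `φ ↦ -∫ ∇ₓ · φ dμ` on `C¹_c(Ω × ℝ^q, ℝ^d)`. -/
def negDivMap (μ : Measure (Ω × Euc q)) [IsFiniteMeasure μ] : testSpace (q := q) Ω →ₗ[ℝ] ℝ where
  toFun φ := -∫ z : Ω × Euc q, divX φ.1 ((z.1 : Euc d), z.2) ∂μ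
  map_add' φ ψ := by
    rw [← neg_add, ← integral_add (IsTest.integrable_divX φ.2 μ) (IsTest.integrable_divX ψ.2 μ)]
    congr 2 with z
    exact divX_add (IsTest.differentiable φ.2 _) (IsTest.differentiable ψ.2 _)
  map_smul' c φ := by
    simp only [Submodule.coe_smul, divX_smul, integral_const_mul, RingHom.id_apply, smul_eq_mul,
      mul_neg]

end Tests

/-! ### Existence of an optimal flux -/

section Existence

variable {Ω : Set (Euc d)}

/-- The matrix field with given entries. -/
def matrixField {X : Type*} [TopologicalSpace X] (ψ : Fin q × Fin d → C_c(X, ℝ)) (z : X) : Mat q d :=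
  WithLp.toLp 2 fun ij => ψ ij z

@[simp]
theorem matrixField_apply {X : Type*} [TopologicalSpace X] (ψ : Fin q × Fin d → C_c(X, ℝ)) (z : X)
    (ij : Fin q × Fin d) : matrixField ψ z ij = ψ ij z := rfl

theorem matrixField_add {X : Type*} [TopologicalSpace X] (ψ χ : Fin q × Fin d → C_c(X, ℝ)) (z : X) :
    matrixField (ψ + χ) z = matrixField ψ z + matrixField χ z := by
  ext ij
  simp

theorem matrixField_smul {X : Type*} [TopologicalSpace X] (c : ℝ) (ψ : Fin q × Fin d → C_c(X, ℝ))
    (z : X) : matrixField (c • ψ) z = c • matrixField ψ z := by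
  ext ij
  simp

theorem matrixField_gradMap (φ : testSpace (q := q) Ω) (z : Ω × Euc q) :
    matrixField (gradMap φ) z = gradY φ.1 ((z.1 : Euc d), z.2) := by
  ext ij
  simp

theorem exists_norm_matrixField_le {X : Type*} [TopologicalSpace X] (ψ : Fin q × Fin d → C_c(X, ℝ)) :
    ∃ B, 0 ≤ B ∧ ∀ z, ‖matrixField ψ z‖ ≤ B := by
  have h : ∀ ij, ∃ B, ∀ z, ‖ψ ij z‖ ≤ B := fun ij =>
    (ψ ij).hasCompactSupport.exists_bound_of_continuous (ψ ij).continuous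
  choose B hB using h
  refine ⟨√(∑ ij, B ij ^ 2), Real.sqrt_nonneg _, fun z => ?_⟩
  rw [EuclideanSpace.norm_eq]
  refine Real.sqrt_le_sqrt (Finset.sum_le_sum fun ij _ => ?_)
  exact pow_le_pow_left₀ (norm_nonneg _) (hB ij z) 2

/-- The homogenised epigraph of `ψ ↦ ∫ W*(ψ) dμ + S`: the pairs `(ψ, a)` for which, for some `t ≥ 0`,
`a ≥ ∫ t W*(ψ / t) dμ + t S`. The integrand is replaced by an integrable `g` above it, so that no
extended-real value occurs; for `t = 0` the condition on `g` reads `ψ = 0` and `g ≥ 0`. -/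
def costCone {X : Type*} [TopologicalSpace X] [MeasurableSpace X] (W : Mat q d → ℝ)
    (μ : Measure X) (S : ℝ) : PointedCone ℝ ((Fin q × Fin d → C_c(X, ℝ)) × ℝ) where
  carrier := {F | ∃ t : ℝ, 0 ≤ t ∧ ∃ g : X → ℝ, Integrable g μ ∧
    (∀ z v, inner ℝ (matrixField F.1 z) v - g z ≤ t * W v) ∧ ∫ z, g z ∂μ + t * S ≤ F.2}
  add_mem' := by
    rintro F F' ⟨t, ht, g, hg, hm, hF⟩ ⟨t', ht', g', hg', hm', hF'⟩
    refine ⟨t + t', add_nonneg ht ht', g + g', hg.add hg', fun z v => ?_, ?_⟩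
    · have h1 := hm z v
      have h2 := hm' z v
      simp only [Prod.fst_add, matrixField_add, inner_add_left, Pi.add_apply]
      linarith
    · simp only [Pi.add_apply, Prod.snd_add]
      rw [integral_add hg hg']
      linarith
  zero_mem' := by
    refine ⟨0, le_rfl, 0, integrable_zero _ _ _, fun z v => ?_, by simp⟩
    have : matrixField (0 : Fin q × Fin d → C_c(X, ℝ)) z = 0 := by ext; simp
    simp [this]
  smul_mem' := by
    rintro ⟨s, hs⟩ F ⟨t, ht, g, hg, hm, hF⟩
    refine ⟨s * t, mul_nonneg hs ht, fun z => s * g z, hg.const_mul s, fun z v => ?_, ?_⟩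
    · have h1 := mul_le_mul_of_nonneg_left (hm z v) hs
      have h2 : matrixField (((⟨s, hs⟩ : {c : ℝ // 0 ≤ c}) • F).1) z = s • matrixField F.1 z := matrixField_smul s F.1 z
      rw [h2, real_inner_smul_left]
      linarith
    · have h1 := mul_le_mul_of_nonneg_left hF hs
      rw [integral_const_mul]
      calc s * ∫ z, g z ∂μ + s * t * S = s * (∫ z, g z ∂μ + t * S) := by ring
        _ ≤ s * F.2 := h1

theorem mem_costCone {X : Type*} [TopologicalSpace X] [MeasurableSpace X] {W : Mat q d → ℝ}
    {μ : Measure X} {S : ℝ} {F : (Fin q × Fin d → C_c(X, ℝ)) × ℝ} :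
    F ∈ costCone W μ S ↔ ∃ t : ℝ, 0 ≤ t ∧ ∃ g : X → ℝ, Integrable g μ ∧
      (∀ z v, inner ℝ (matrixField F.1 z) v - g z ≤ t * W v) ∧ ∫ z, g z ∂μ + t * S ≤ F.2 := Iff.rfl

/-- The number `S` bounds the dual problem: `-∫ (∇ₓ · φ + g) dμ ≤ S` for all `φ ∈ C¹_c` and all
integrable `g ≥ W*(∇_y φ)`. -/
def IsDualBound (W : Mat q d → ℝ) (μ : Measure (Ω × Euc q)) (S : ℝ) : Prop :=
  ∀ φ : Euc d × Euc q → Euc d, IsTest 1 Ω φ → ∀ g : Ω × Euc q → ℝ, Integrable g μ →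
    (∀ z : Ω × Euc q, IsAffineMinorant W (gradY φ ((z.1 : Euc d), z.2)) (g z)) →
    -∫ z : Ω × Euc q, divX φ ((z.1 : Euc d), z.2) ∂μ ≤ ∫ z, g z ∂μ + S

variable {W : Mat q d → ℝ} {μ : Measure (Ω × Euc q)} [IsFiniteMeasure μ] {S : ℝ}

/-- The homogeneous form of the dual bound. For `t > 0` it is the bound for `φ / t`; the case `t = 0` is
reached by replacing `t` with `t + ε`, which is harmless because `W` is nonnegative. -/
theorem IsDualBound.negDivMap_le (hS : IsDualBound W μ S) (hW : ∀ v, 0 ≤ W v)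
    (φ : testSpace (q := q) Ω) {t : ℝ} (ht : 0 ≤ t) {g : Ω × Euc q → ℝ} (hg : Integrable g μ)
    (h : ∀ z v, inner ℝ (matrixField (gradMap φ) z) v - g z ≤ t * W v) :
    negDivMap μ φ ≤ ∫ z, g z ∂μ + t * S := by
  have key : ∀ ε > 0, negDivMap μ φ ≤ ∫ z, g z ∂μ + (t + ε) * S := by
    intro ε hε
    have hs : 0 < t + ε := by linarith
    have h1 := hS ((t + ε)⁻¹ • φ.1) (φ.2.const_smul _) (fun z => (t + ε)⁻¹ * g z)
      (hg.const_mul _) (fun z v => by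
        have h2 := h z v
        rw [matrixField_gradMap] at h2
        rw [gradY_smul, real_inner_smul_left, ← mul_sub, inv_mul_le_iff₀ hs]
        nlinarith [hW v])
    simp only [divX_smul, integral_const_mul] at h1
    have h3 : negDivMap μ φ = -∫ z : Ω × Euc q, divX φ.1 ((z.1 : Euc d), z.2) ∂μ := rfl
    rw [h3]
    have h4 := mul_le_mul_of_nonneg_left h1 hs.le
    rw [mul_add, mul_neg, mul_inv_cancel_left₀ hs.ne', mul_inv_cancel_left₀ hs.ne'] at h4
    exact h4
  have hlim : Tendsto (fun ε : ℝ => ∫ z, g z ∂μ + (t + ε) * S) (nhdsWithin 0 (Set.Ioi 0))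
      (nhds (∫ z, g z ∂μ + (t + 0) * S)) := by
    refine Tendsto.mono_left ?_ nhdsWithin_le_nhds
    exact Continuous.tendsto (by fun_prop) _
  rw [add_zero] at hlim
  exact ge_of_tendsto hlim (eventually_mem_nhdsWithin.mono fun ε hε => key ε hε)

/-- Extension of `∇_y φ ↦ -∫ ∇ₓ · φ dμ` from gradients to all continuous compactly supported fields,
keeping the domination by `ψ ↦ ∫ W*(ψ) dμ + S`. -/
theorem IsDualBound.exists_linearMap (hS : IsDualBound W μ S) (hW : ∀ v, 0 ≤ W v)
    {C₁ C : ℝ} (hC₁ : 0 < C₁) (hgrowth : ∀ v, C₁ * ‖v‖ - C ≤ W v) :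
    ∃ Λ : (Fin q × Fin d → C_c(Ω × Euc q, ℝ)) →ₗ[ℝ] ℝ,
      (∀ φ, Λ (gradMap φ) = negDivMap μ φ) ∧
      ∀ ψ (t : ℝ) (g : Ω × Euc q → ℝ), 0 ≤ t → Integrable g μ →
        (∀ z v, inner ℝ (matrixField ψ z) v - g z ≤ t * W v) → Λ ψ ≤ ∫ z, g z ∂μ + t * S := by
  -- The linear form is well defined on gradients: `∇_y φ = 0` forces `∫ ∇ₓ · φ dμ = 0`, by the dual
  -- bound with `t = 0` and `g = 0` for `φ` and `-φ`.
  obtain ⟨ℓ, hℓ⟩ : ∃ ℓ : Module.Dual ℝ (Fin q × Fin d → C_c(Ω × Euc q, ℝ)),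
      (gradMap (Ω := Ω)).dualMap ℓ = negDivMap μ := by
    rw [← LinearMap.mem_range, LinearMap.range_dualMap_eq_dualAnnihilator_ker,
      Submodule.mem_dualAnnihilator]
    have hle : ∀ φ : testSpace (q := q) Ω, gradMap φ = 0 → negDivMap μ φ ≤ 0 := fun φ hφ => by
      simpa using hS.negDivMap_le hW φ le_rfl (integrable_zero _ ℝ μ) (fun z v => by
        have : matrixField (gradMap φ) z = 0 := by rw [hφ]; ext; simp
        simp [this])
    intro φ hφ
    rw [LinearMap.mem_ker] at hφ
    refine le_antisymm (hle φ hφ) ?_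
    have := hle (-φ) (by rw [map_neg, hφ, neg_zero])
    rw [map_neg] at this
    linarith
  have hℓ' : ∀ φ, ℓ (gradMap φ) = negDivMap μ φ := fun φ => by rw [← hℓ]; rfl
  let dom : Submodule ℝ ((Fin q × Fin d → C_c(Ω × Euc q, ℝ)) × ℝ) :=
    (LinearMap.range (gradMap (Ω := Ω))).prod ⊤
  -- The form `(∇_y φ, a) ↦ a + ∫ ∇ₓ · φ dμ` is nonnegative on the cone by the dual bound.
  let f₀ : (Fin q × Fin d → C_c(Ω × Euc q, ℝ)) × ℝ →ₗ[ℝ] ℝ :=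
    LinearMap.snd ℝ _ _ - ℓ.comp (LinearMap.fst ℝ _ _)
  obtain ⟨G, hG, hGK⟩ := riesz_extension (costCone W μ S) ⟨dom, f₀.comp dom.subtype⟩ (by
      rintro ⟨⟨ψ, a⟩, hψ⟩ hK
      obtain ⟨φ, rfl⟩ : ∃ φ, gradMap φ = ψ := hψ.1
      obtain ⟨t, ht, g, hg, hm, ha⟩ := mem_costCone.1 hK
      have := hS.negDivMap_le hW φ ht hg hm
      rw [← hℓ'] at this
      change 0 ≤ a - ℓ (gradMap φ)
      simp only at ha
      linarith) (by
      rintro ⟨ψ, b⟩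
      obtain ⟨B, hB0, hB⟩ := exists_norm_matrixField_le ψ
      -- By the growth of `W`, `t W*(ψ / t) ≤ t C` as soon as `‖ψ‖ ≤ t C₁`; hence `t = B / C₁`.
      refine ⟨⟨(0, ∫ _, B / C₁ * C ∂μ + B / C₁ * S - b), Submodule.zero_mem _, trivial⟩,
        mem_costCone.2 ⟨B / C₁, by positivity, fun _ => B / C₁ * C, integrable_const _,
          fun z v => ?_, by simp⟩⟩
      simp only [Prod.fst_add, zero_add]
      calc inner ℝ (matrixField ψ z) v - B / C₁ * C ≤ B * ‖v‖ - B / C₁ * C := by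
            gcongr
            exact (real_inner_le_norm _ _).trans (by gcongr; exact hB z)
        _ = B / C₁ * (C₁ * ‖v‖ - C) := by field_simp
        _ ≤ B / C₁ * W v := by gcongr; exact hgrowth v)
  have hGd : ∀ φ a, G (gradMap φ, a) = a - negDivMap μ φ := fun φ a => by
    rw [← hℓ']; exact hG ⟨(gradMap φ, a), ⟨φ, rfl⟩, trivial⟩
  have hG1 : ∀ a, G (0, a) = a := fun a => by simpa using hGd 0 a
  refine ⟨-G.comp (LinearMap.inl ℝ _ _), fun φ => ?_, fun ψ t g ht hg hm => ?_⟩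
  · have := hGd φ 0
    simp only [LinearMap.neg_apply, LinearMap.comp_apply, LinearMap.inl_apply]
    linarith
  · have h1 : 0 ≤ G (ψ, ∫ z, g z ∂μ + t * S) := hGK _ ⟨t, ht, g, hg, hm, le_rfl⟩
    have h2 : ((ψ, ∫ z, g z ∂μ + t * S) : (Fin q × Fin d → C_c(Ω × Euc q, ℝ)) × ℝ) =
        (ψ, 0) + (0, ∫ z, g z ∂μ + t * S) := by simp
    rw [h2, map_add, hG1] at h1
    simp only [LinearMap.neg_apply, LinearMap.comp_apply, LinearMap.inl_apply]
    linarith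

/-- A real upper bound `S` of the dual problem is attained by a flux: some `J` solves the continuity
equation with `B_W(μ, J) ≤ S`. -/
theorem IsDualBound.exists_continuityEq_energy_le (hΩ : IsOpen Ω) (hS : IsDualBound W μ S)
    (hW : ∀ v, 0 ≤ W v) (hWc : ConvexOn ℝ Set.univ W)
    {C₁ C : ℝ} (hC₁ : 0 < C₁) (hgrowth : ∀ v, C₁ * ‖v‖ - C ≤ W v) :
    ∃ J : VectorMeasure (Ω × Euc q) (Mat q d),
      ContinuityEq μ J ∧ energy W μ J ≤ ENNReal.ofReal S := by
  have : LocallyCompactSpace Ω := hΩ.locallyCompactSpace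
  obtain ⟨Λ, hΛ, hΛS⟩ := hS.exists_linearMap hW hC₁ hgrowth
  -- Domination with `t = M / C₁` bounds `Λ` on fields of norm at most `M`.
  have hbd : ∀ ij (f : C_c(Ω × Euc q, ℝ)) M, 0 ≤ M → (∀ x, |f x| ≤ M) →
      Λ (Pi.single ij f) ≤ (μ.real Set.univ * C + S) / C₁ * M := by
    intro ij f M hM hf
    have hn : ∀ z, ‖matrixField (Pi.single ij f) z‖ ≤ M := fun z => by
      have : matrixField (Pi.single ij f) z = EuclideanSpace.single ij (f z) := by
        ext kl
        by_cases h : kl = ij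
        · subst h; simp
        · simp [h]
      rw [this, PiLp.norm_single]
      exact hf z
    have h := hΛS (Pi.single ij f) (M / C₁) (fun _ => M / C₁ * C) (by positivity)
      (integrable_const _) (fun z v => ?_)
    · refine h.trans (le_of_eq ?_)
      rw [integral_const, smul_eq_mul]
      ring
    · calc inner ℝ (matrixField (Pi.single ij f) z) v - M / C₁ * C ≤ M * ‖v‖ - M / C₁ * C := by
            gcongr
            exact (real_inner_le_norm _ _).trans (by gcongr; exact hn z)
        _ = M / C₁ * (C₁ * ‖v‖ - C) := by field_simp
        _ ≤ M / C₁ * W v := by gcongr; exact hgrowth v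
  have hex : ∀ ij, ∃ ν₁ ν₂ : Measure (Ω × Euc q), IsFiniteMeasure ν₁ ∧ IsFiniteMeasure ν₂ ∧
      ∀ f : C_c(Ω × Euc q, ℝ), Λ (Pi.single ij f) = ∫ x, f x ∂ν₁ - ∫ x, f x ∂ν₂ := fun ij =>
    exists_measure_sub_of_bounded (X := Ω × Euc q)
      (Λ.comp (LinearMap.single ℝ (fun _ : Fin q × Fin d => C_c(Ω × Euc q, ℝ)) ij)) _ (hbd ij)
  choose ν₁ ν₂ hν₁ hν₂ hν using hex
  let J : VectorMeasure (Ω × Euc q) (Mat q d) :=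
    ofEntries fun ij => (ν₁ ij).toSignedMeasure - (ν₂ ij).toSignedMeasure
  have hJ : ∀ ψ : Fin q × Fin d → C_c(Ω × Euc q, ℝ), ∑ ij, ∫ᵛ z, ψ ij z ∂•(entry J ij) = Λ ψ := by
    intro ψ
    have h1 : ψ = ∑ ij, Pi.single ij (ψ ij) := (Finset.univ_sum_single ψ).symm
    conv_rhs => rw [h1, map_sum]
    refine Finset.sum_congr rfl fun ij _ => ?_
    have hi : ∀ (σ : Measure (Ω × Euc q)) [IsFiniteMeasure σ],
        σ.toSignedMeasure.Integrable (ψ ij) := fun σ _ => by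
      rw [VectorMeasure.Integrable, Measure.variation_toSignedMeasure]
      exact (ψ ij).continuous.integrable_of_hasCompactSupport (ψ ij).hasCompactSupport
    rw [entry_ofEntries, VectorMeasure.integral_sub_vectorMeasure (hi _) (hi _),
      integral_vectorMeasure_toSignedMeasure, integral_vectorMeasure_toSignedMeasure, hν]
  refine ⟨J, fun φ hφ => ?_, ?_⟩
  · have h1 : IsTest 1 Ω φ := hφ.mono le_top
    have h2 := hJ (gradMap ⟨φ, h1⟩)
    rw [hΛ] at h2
    have h3 : negDivMap μ ⟨φ, h1⟩ = -∫ z : Ω × Euc q, divX φ ((z.1 : Euc d), z.2) ∂μ := rfl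
    simp only [gradMap_apply] at h2
    rw [h2, h3, add_neg_cancel]
  · refine lintegral_add_lintegral_recession_le hW hWc
      (variation_singPart_mutuallySingular J μ).symm (measurable_density _ _)
      (measurable_density _ _) (integrable_density _ _) (integrable_density _ _) ?_
    intro ψ g hψ hψs hg hm
    obtain ⟨B, hB⟩ := hψs.exists_bound_of_continuous hψ
    rw [← sum_integral_entry_eq J μ hψ.measurable hB]
    let ψ' : Fin q × Fin d → C_c(Ω × Euc q, ℝ) := fun ij =>
      ⟨⟨fun z => ψ z ij, (EuclideanSpace.proj (𝕜 := ℝ) ij).continuous.comp hψ⟩,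
        hψs.comp_left (g := fun r : Mat q d => r ij) rfl⟩
    have h1 := hΛS ψ' 1 g zero_le_one hg (fun z v => by rw [one_mul]; exact hm z v)
    rw [← hJ, one_mul] at h1
    exact h1

end Existence

/-! ### Mollification of test functions -/

section WeakDuality

variable {Ω : Set (Euc d)}

/-- Mollification of a compactly supported `C¹` function: smooth functions supported in the same open set
whose derivatives are uniformly bounded and converge pointwise. -/
theorem exists_seq_contDiff_tendsto_fderiv {G F : Type*} [NormedAddCommGroup G] [NormedSpace ℝ G]
    [FiniteDimensional ℝ G] [MeasurableSpace G] [BorelSpace G] [NormedAddCommGroup F]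
    [NormedSpace ℝ F] [CompleteSpace F] {f : G → F} (hf : ContDiff ℝ 1 f)
    (hfs : HasCompactSupport f) {U : Set G} (hU : IsOpen U) (hfU : tsupport f ⊆ U) :
    ∃ g : ℕ → G → F, (∀ n, ContDiff ℝ ∞ (g n) ∧ HasCompactSupport (g n) ∧ tsupport (g n) ⊆ U) ∧
      (∃ B, ∀ n z, ‖fderiv ℝ (g n) z‖ ≤ B) ∧
      ∀ z, Tendsto (fun n => fderiv ℝ (g n) z) atTop (nhds (fderiv ℝ f z)) := by
  obtain ⟨δ, hδ, hδU⟩ := hfs.isCompact.exists_cthickening_subset_open hU hfU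
  let lam : Measure G := Measure.addHaar
  have hpos : ∀ n : ℕ, 0 < δ / ((n : ℝ) + 1) := fun n => by positivity
  let ρ : ℕ → ContDiffBump (0 : G) := fun n => ⟨δ / ((n : ℝ) + 1) / 2, δ / ((n : ℝ) + 1),
    half_pos (hpos n), half_lt_self (hpos n)⟩
  have hρδ : ∀ n, (ρ n).rOut ≤ δ := fun n => by
    change δ / ((n : ℝ) + 1) ≤ δ
    exact div_le_self hδ.le (by linarith [(Nat.cast_nonneg n : (0 : ℝ) ≤ n)])
  have hρ0 : Tendsto (fun n => (ρ n).rOut) atTop (nhds 0) := by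
    have := (tendsto_one_div_add_atTop_nhds_zero_nat (𝕜 := ℝ)).const_mul δ
    simpa [ρ, div_eq_mul_inv] using this
  have hf'c : Continuous (fderiv ℝ f) := hf.continuous_fderiv one_ne_zero
  obtain ⟨B, hB⟩ := (hfs.fderiv ℝ).exists_bound_of_continuous hf'c
  let g : ℕ → G → F := fun n => convolution ((ρ n).normed lam) f (ContinuousLinearMap.lsmul ℝ ℝ) lam
  have hder : ∀ n z, fderiv ℝ (g n) z =
      convolution ((ρ n).normed lam) (fderiv ℝ f) (ContinuousLinearMap.lsmul ℝ ℝ) lam z := by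
    intro n z
    have h1 := hfs.hasFDerivAt_convolution_right (ContinuousLinearMap.lsmul ℝ ℝ)
      ((ρ n).continuous_normed (μ := lam)).locallyIntegrable hf z (μ := lam)
    rw [h1.fderiv]
    congr 1
  have hsup : ∀ n, tsupport (g n) ⊆ Metric.cthickening δ (tsupport f) := by
    intro n
    refine closure_minimal ?_ Metric.isClosed_cthickening
    refine (support_convolution_subset _).trans ?_
    rintro _ ⟨a, ha, b, hb, rfl⟩
    rw [(ρ n).support_normed_eq, Metric.mem_ball] at ha
    refine Metric.mem_cthickening_of_dist_le _ b _ _ (subset_tsupport f hb) ?_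
    rw [dist_zero_right] at ha
    rw [dist_eq_norm, add_sub_cancel_right]
    exact ha.le.trans (hρδ n)
  refine ⟨g, fun n => ⟨?_, ?_, (hsup n).trans hδU⟩, ⟨B + (B + B), fun n z => ?_⟩, fun z => ?_⟩
  · exact (ρ n).hasCompactSupport_normed.contDiff_convolution_left _ (ρ n).contDiff_normed
      hf.continuous.locallyIntegrable
  · exact hfs.isCompact.cthickening.of_isClosed_subset (isClosed_tsupport _) (hsup n)
  · rw [hder]
    have h1 := (ρ n).dist_normed_convolution_le (μ := lam) (g := fderiv ℝ f) (x₀ := z) (ε := B + B)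
      hf'c.aestronglyMeasurable (fun x _ => by
        rw [dist_eq_norm]
        exact (norm_sub_le _ _).trans (add_le_add (hB x) (hB z)))
    rw [dist_eq_norm] at h1
    exact (norm_le_norm_add_norm_sub' _ _).trans (add_le_add (hB z) h1)
  · simp only [hder]
    exact ContDiffBump.convolution_tendsto_right_of_continuous hρ0 hf'c z

/-- The continuity equation, assumed for smooth test functions, holds for `C¹` ones. -/
theorem ContinuityEq.of_isTest_one (hΩ : IsOpen Ω) {μ : Measure (Ω × Euc q)} [IsFiniteMeasure μ]
    {J : VectorMeasure (Ω × Euc q) (Mat q d)} (hJ : ContinuityEq μ J)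
    {φ : Euc d × Euc q → Euc d} (hφ : IsTest 1 Ω φ) :
    ∫ z : Ω × Euc q, divX φ ((z.1 : Euc d), z.2) ∂μ +
      ∑ ij : Fin q × Fin d, ∫ᵛ z : Ω × Euc q, gradY φ ((z.1 : Euc d), z.2) ij ∂•(entry J ij)
        = 0 := by
  obtain ⟨g, hg, ⟨B, hB⟩, hlim⟩ := exists_seq_contDiff_tendsto_fderiv hφ.contDiff
    hφ.hasCompactSupport (hΩ.prod isOpen_univ) hφ.tsupport_subset
  have hgt : ∀ n, IsTest (⊤ : ℕ∞) Ω (g n) := fun n => ⟨(hg n).1, (hg n).2.1, (hg n).2.2⟩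
  have hgt1 : ∀ n, IsTest 1 Ω (g n) := fun n => (hgt n).mono le_top
  have hcoord : ∀ (u : Euc d × Euc q) (j : Fin d), ‖u‖ ≤ 1 → ∀ n z,
      ‖fderiv ℝ (g n) z u j‖ ≤ B := fun u j hu n z =>
    (PiLp.norm_apply_le _ _).trans (((fderiv ℝ (g n) z).le_of_opNorm_le (hB n z) u).trans
      (mul_le_of_le_one_right ((norm_nonneg _).trans (hB n z)) hu))
  have hcoordlim : ∀ (u : Euc d × Euc q) (j : Fin d) z,
      Tendsto (fun n => fderiv ℝ (g n) z u j) atTop (nhds (fderiv ℝ φ z u j)) := fun u j z =>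
    ((EuclideanSpace.proj (𝕜 := ℝ) j).continuous.tendsto _).comp
      (((ContinuousLinearMap.apply ℝ (Euc d) u).continuous.tendsto _).comp (hlim z))
  have L1 : Tendsto (fun n => ∫ z : Ω × Euc q, divX (g n) ((z.1 : Euc d), z.2) ∂μ) atTop
      (nhds (∫ z : Ω × Euc q, divX φ ((z.1 : Euc d), z.2) ∂μ)) := by
    refine tendsto_integral_of_dominated_convergence (fun _ => ∑ _j : Fin d, B) ?_
      (integrable_const _) ?_ ?_
    · exact fun n => (hgt1 n).continuous_divX_coe.measurable.aestronglyMeasurable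
    · refine fun n => Eventually.of_forall fun z => norm_sum_le_of_le _ fun j _ => ?_
      exact hcoord _ j (by simp) n _
    · exact Eventually.of_forall fun z => tendsto_finsetSum _ fun j _ => hcoordlim _ j _
  have L2 : Tendsto (fun n => ∑ ij : Fin q × Fin d,
      ∫ᵛ z : Ω × Euc q, gradY (g n) ((z.1 : Euc d), z.2) ij ∂•(entry J ij)) atTop
      (nhds (∑ ij : Fin q × Fin d,
        ∫ᵛ z : Ω × Euc q, gradY φ ((z.1 : Euc d), z.2) ij ∂•(entry J ij))) := by
    refine tendsto_finsetSum _ fun ij _ => ?_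
    refine VectorMeasure.tendsto_integral_of_dominated_convergence (fun _ => B) ?_
      (integrable_const _) ?_ ?_
    · exact fun n => ((EuclideanSpace.proj (𝕜 := ℝ) ij : Mat q d →L[ℝ] ℝ).continuous.comp
        (hgt1 n).continuous_gradY_coe).measurable.aestronglyMeasurable
    · exact fun n => Eventually.of_forall fun z => hcoord _ ij.2 (by simp) n _
    · exact Eventually.of_forall fun z => hcoordlim _ ij.2 _
  refine tendsto_nhds_unique (L1.add L2) ?_
  exact tendsto_const_nhds.congr fun n => (hJ (g n) (hgt n)).symm

/-! ### Bounds on the extended-real integral -/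

section EReal
variable {X : Type*} [MeasurableSpace X] {μ : Measure X} {u : X → EReal} {G : X → ℝ}

theorem coe_integral_eq_sub (hG : Integrable G μ) :
    ((∫ z, G z ∂μ : ℝ) : EReal) = ((∫⁻ z, ENNReal.ofReal (G z) ∂μ : ℝ≥0∞) : EReal) -
      ((∫⁻ z, ENNReal.ofReal (-G z) ∂μ : ℝ≥0∞) : EReal) := by
  rw [integral_eq_lintegral_pos_part_sub_lintegral_neg_part hG, EReal.coe_sub,
    EReal.coe_ennreal_toReal hG.lintegral_lt_top.ne,
    EReal.coe_ennreal_toReal (show ∫⁻ z, ENNReal.ofReal (-G z) ∂μ ≠ ⊤ from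
      hG.neg.lintegral_lt_top.ne)]

/-- No measurability of `u` is needed: the positive and negative parts are compared separately, and those
of `G` have finite integrals. -/
theorem erealIntegral_le_integral (hG : Integrable G μ) (h : ∀ z, u z ≤ (G z : EReal)) :
    erealIntegral μ u ≤ ((∫ z, G z ∂μ : ℝ) : EReal) := by
  rw [coe_integral_eq_sub hG, erealIntegral]
  refine EReal.sub_le_sub ?_ ?_
  · refine EReal.coe_ennreal_le_coe_ennreal_iff.2 (lintegral_mono fun z => ?_)
    simpa using EReal.toENNReal_le_toENNReal (h z)
  · refine EReal.coe_ennreal_le_coe_ennreal_iff.2 (lintegral_mono fun z => ?_)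
    have := EReal.toENNReal_le_toENNReal (EReal.neg_le_neg_iff.2 (h z))
    rw [← EReal.coe_neg] at this
    simpa using this

theorem integral_le_erealIntegral (hG : Integrable G μ) (h : ∀ z, (G z : EReal) ≤ u z) :
    ((∫ z, G z ∂μ : ℝ) : EReal) ≤ erealIntegral μ u := by
  rw [coe_integral_eq_sub hG, erealIntegral]
  refine EReal.sub_le_sub ?_ ?_
  · refine EReal.coe_ennreal_le_coe_ennreal_iff.2 (lintegral_mono fun z => ?_)
    simpa using EReal.toENNReal_le_toENNReal (h z)
  · refine EReal.coe_ennreal_le_coe_ennreal_iff.2 (lintegral_mono fun z => ?_)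
    have := EReal.toENNReal_le_toENNReal (EReal.neg_le_neg_iff.2 (h z))
    rw [← EReal.coe_neg] at this
    simpa using this

end EReal

/-! ### Weak duality -/

variable {W : Mat q d → ℝ} {μ : Measure (Ω × Euc q)}

theorem dualAdmissible_zero (hW : ∀ v, 0 ≤ W v) :
    DualAdmissible W Ω (0 : Euc d × Euc q → Euc d) := by
  refine ⟨isTest_zero 1, fun x _ y => ?_⟩
  have h0 : gradY (0 : Euc d × Euc q → Euc d) (x, y) = 0 := by
    have := gradY_smul 0 (0 : Euc d × Euc q → Euc d) (x, y)
    rwa [zero_smul, zero_smul] at this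
  rw [h0]
  exact (legendre_le_coe_iff.2 (isAffineMinorant_zero hW)).trans_lt (EReal.coe_lt_top _)

theorem dualValue_zero_nonneg (hW : ∀ v, 0 ≤ W v) :
    0 ≤ dualValue W μ (0 : Euc d × Euc q → Euc d) := by
  have h0 : ∀ z, gradY (0 : Euc d × Euc q → Euc d) z = 0 := fun z => by
    have := gradY_smul 0 (0 : Euc d × Euc q → Euc d) z
    rwa [zero_smul, zero_smul] at this
  have h1 : ∀ z, divX (0 : Euc d × Euc q → Euc d) z = 0 := fun z => by
    have := divX_smul 0 (0 : Euc d × Euc q → Euc d) z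
    rwa [zero_smul, zero_mul] at this
  rw [dualValue, EReal.neg_nonneg]
  refine (erealIntegral_le_integral (G := fun _ => 0) (integrable_zero _ _ _) fun z => ?_).trans
    (by simp)
  simp only [h0, h1, EReal.coe_zero, zero_add]
  exact_mod_cast legendre_le_coe_iff.2 (isAffineMinorant_zero hW)

variable [IsFiniteMeasure μ]

/-- Weak duality. -/
theorem dualValue_le_energy (hΩ : IsOpen Ω) (hW : ∀ v, 0 ≤ W v) (hWc : ConvexOn ℝ Set.univ W)
    {J : VectorMeasure (Ω × Euc q) (Mat q d)} (hJ : ContinuityEq μ J)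
    {φ : Euc d × Euc q → Euc d} (hφ : DualAdmissible W Ω φ) :
    dualValue W μ φ ≤ ((energy W μ J : ℝ≥0∞) : EReal) := by
  by_cases htop : energy W μ J = ⊤
  · simp [htop]
  obtain ⟨hφ1, hφW⟩ := hφ
  set v := density J μ with hv
  set ν := (singPart J μ).variation with hν
  set h := density (singPart J μ) ν with hh
  have hE : energy W μ J = ∫⁻ z, ENNReal.ofReal (W (v z)) ∂μ + ∫⁻ z, recession W (h z) ∂ν := rfl
  obtain ⟨h1, h2⟩ := ENNReal.add_ne_top.1 (hE ▸ htop)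
  have hWm : Measurable fun z => W (v z) :=
    (continuous_of_convexOn_univ hWc).measurable.comp (measurable_density J μ)
  have hWi : Integrable (fun z => W (v z)) μ := by
    refine ⟨hWm.aestronglyMeasurable, ?_⟩
    rw [hasFiniteIntegral_iff_ofReal (Eventually.of_forall fun z => hW _)]
    exact h1.lt_top
  let ψ : Ω × Euc q → Mat q d := fun z => gradY φ ((z.1 : Euc d), z.2)
  have hψc : Continuous ψ := hφ1.continuous_gradY_coe
  obtain ⟨B, hB⟩ := hφ1.hasCompactSupport_gradY.exists_bound_of_continuous hψc
  have hJφ := hJ.of_isTest_one hΩ hφ1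
  rw [sum_integral_entry_eq J μ (ψ := ψ) hψc.measurable hB] at hJφ
  have hψi : ∀ (σ : Measure (Ω × Euc q)) (k : Ω × Euc q → Mat q d), Integrable k σ →
      Measurable k → Integrable (fun z => inner ℝ (ψ z) (k z)) σ := by
    intro σ k hk hkm
    refine (hk.norm.const_mul B).mono' (hψc.measurable.inner hkm).aestronglyMeasurable ?_
    exact Eventually.of_forall fun z => (norm_inner_le_norm _ _).trans
      (mul_le_mul_of_nonneg_right (hB z) (norm_nonneg _))
  have hi1 := hψi μ v (integrable_density _ _) (measurable_density _ _)
  have hi2 := hψi ν h (integrable_density _ _) (measurable_density _ _)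
  have hrec : ∫ z, inner ℝ (ψ z) (h z) ∂ν ≤ (∫⁻ z, recession W (h z) ∂ν).toReal := by
    have hle : ∫⁻ z, ENNReal.ofReal (inner ℝ (ψ z) (h z)) ∂ν ≤ ∫⁻ z, recession W (h z) ∂ν := by
      refine lintegral_mono fun z => ?_
      obtain ⟨c, hc⟩ := exists_isAffineMinorant_of_legendre_lt_top (hφW z.1 z.1.2 z.2)
      exact hc.inner_le_recession _
    rw [integral_eq_lintegral_pos_part_sub_lintegral_neg_part hi2]
    exact (sub_le_self _ ENNReal.toReal_nonneg).trans (ENNReal.toReal_mono h2 hle)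
  have hlow := integral_le_erealIntegral (μ := μ)
    (G := fun z => divX φ ((z.1 : Euc d), z.2) + (inner ℝ (ψ z) (v z) - W (v z)))
    (u := fun z : Ω × Euc q => ((divX φ ((z.1 : Euc d), z.2) : ℝ) : EReal) +
      legendre W (gradY φ ((z.1 : Euc d), z.2)))
    ((hφ1.integrable_divX μ).add (hi1.sub hWi)) (fun z => by
      rw [EReal.coe_add]
      exact add_le_add_right (coe_le_legendre W _ _) _)
  rw [integral_add (g := fun z => inner ℝ (ψ z) (v z) - W (v z)) (hφ1.integrable_divX μ)
    (hi1.sub hWi), integral_sub hi1 hWi] at hlow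
  rw [dualValue]
  refine (EReal.neg_le_neg_iff.2 hlow).trans ?_
  rw [← EReal.coe_ennreal_toReal htop, ← EReal.coe_neg, EReal.coe_le_coe_iff, hE,
    ENNReal.toReal_add h1 h2, ← ofReal_integral_eq_lintegral_ofReal hWi
      (Eventually.of_forall fun z => hW _), ENNReal.toReal_ofReal (integral_nonneg fun z => hW _)]
  linarith

theorem isDualBound_of_forall_dualValue_le {S : ℝ}
    (hS : ∀ φ, DualAdmissible W Ω φ → dualValue W μ φ ≤ (S : EReal)) : IsDualBound W μ S := by
  intro φ hφ g hg hm
  have hadm : DualAdmissible W Ω φ := ⟨hφ, fun x hx y =>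
    (legendre_le_coe_iff.2 (hm (⟨x, hx⟩, y))).trans_lt (EReal.coe_lt_top _)⟩
  have h1 := erealIntegral_le_integral (μ := μ)
    (G := fun z => divX φ ((z.1 : Euc d), z.2) + g z)
    (u := fun z : Ω × Euc q => ((divX φ ((z.1 : Euc d), z.2) : ℝ) : EReal) +
      legendre W (gradY φ ((z.1 : Euc d), z.2)))
    ((hφ.integrable_divX μ).add hg) (fun z => by
      rw [EReal.coe_add]
      exact add_le_add_right (legendre_le_coe_iff.2 (hm z)) _)
  have h2 := (EReal.neg_le_neg_iff.2 h1).trans (hS φ hadm)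
  rw [← EReal.coe_neg, EReal.coe_le_coe_iff, integral_add (hφ.integrable_divX μ) hg] at h2
  linarith

end WeakDuality

end EulerianLifting

end

theorem mainTheorem3 {d q : ℕ} (hd : 1 ≤ d) (hq : 1 ≤ q)
    (Ω : Set (EulerianLifting.Euc d)) (hΩ : IsOpen Ω) (hΩb : Bornology.IsBounded Ω)
    (W : EulerianLifting.Mat q d → ℝ) (hWnonneg : ∀ v, 0 ≤ W v)
    (hWconv : ConvexOn ℝ Set.univ W)
    (p : ℝ) (hp : 1 ≤ p) (C₁ C₂ : ℝ) (hC₁ : 0 < C₁) (hC₂ : 0 ≤ C₂)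
    (hWgrowth : ∀ v, C₁ * ‖v‖ ^ p - C₂ ≤ W v)
    (μ : Measure (Ω × EulerianLifting.Euc q)) [IsFiniteMeasure μ]
    (hμ : μ.map (fun z => (z.1 : EulerianLifting.Euc d)) = volume.restrict Ω) :
    ((EulerianLifting.lifting W μ : ℝ≥0∞) : EReal) =
        (⨆ (φ : EulerianLifting.Euc d × EulerianLifting.Euc q → EulerianLifting.Euc d)
          (_ : EulerianLifting.DualAdmissible W Ω φ), EulerianLifting.dualValue W μ φ) ∧
      ((∃ J, EulerianLifting.ContinuityEq μ J) →
        ∃ J, EulerianLifting.ContinuityEq μ J ∧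
          EulerianLifting.energy W μ J = EulerianLifting.lifting W μ) := by
  -- Growth of order `p ≥ 1` implies linear growth, as `s - 1 ≤ s ^ p` for `s ≥ 0`.
  have hgrowth : ∀ v, C₁ * ‖v‖ - (C₁ + C₂) ≤ W v := fun v => by
    have h1 : ‖v‖ - 1 ≤ ‖v‖ ^ p := by
      rcases le_total 1 ‖v‖ with h | h
      · linarith [Real.self_le_rpow_of_one_le h hp]
      · linarith [Real.rpow_nonneg (norm_nonneg v) p]
    nlinarith [hWgrowth v]
  set D : EReal := ⨆ (φ : EulerianLifting.Euc d × EulerianLifting.Euc q → EulerianLifting.Euc d)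
    (_ : EulerianLifting.DualAdmissible W Ω φ), EulerianLifting.dualValue W μ φ with hD
  have hleD : ∀ φ, EulerianLifting.DualAdmissible W Ω φ → EulerianLifting.dualValue W μ φ ≤ D :=
    fun φ hφ => le_iSup₂_of_le φ hφ le_rfl
  have hD0 : 0 ≤ D := (EulerianLifting.dualValue_zero_nonneg hWnonneg).trans
    (hleD 0 (EulerianLifting.dualAdmissible_zero hWnonneg))
  have hweak : ∀ J, EulerianLifting.ContinuityEq μ J →
      D ≤ ((EulerianLifting.energy W μ J : ℝ≥0∞) : EReal) := fun J hJ =>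
    iSup₂_le fun φ hφ => EulerianLifting.dualValue_le_energy hΩ hWnonneg hWconv hJ hφ
  have hDn : ((D.toENNReal : ℝ≥0∞) : EReal) = D := EReal.coe_toENNReal hD0
  have hDle : D.toENNReal ≤ EulerianLifting.lifting W μ := by
    refine le_iInf₂ fun J hJ => ?_
    rw [← EReal.coe_ennreal_le_coe_ennreal_iff, hDn]
    exact hweak J hJ
  by_cases hDtop : D = ⊤
  · have htop : EulerianLifting.lifting W μ = ⊤ := by
      rw [hDtop, EReal.toENNReal_top, top_le_iff] at hDle
      exact hDle
    refine ⟨by rw [htop, hDtop]; rfl, ?_⟩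
    rintro ⟨J, hJ⟩
    refine ⟨J, hJ, le_antisymm (htop ▸ le_top) (iInf₂_le J hJ)⟩
  · have hDreal : ((D.toReal : ℝ) : EReal) = D :=
      EReal.coe_toReal hDtop (ne_bot_of_le_ne_bot EReal.zero_ne_bot hD0)
    obtain ⟨J, hJ, hJle⟩ := (EulerianLifting.isDualBound_of_forall_dualValue_le (S := D.toReal)
      fun φ hφ => hDreal.symm ▸ hleD φ hφ).exists_continuityEq_energy_le hΩ hWnonneg hWconv hC₁
        hgrowth
    have hJle' : EulerianLifting.energy W μ J ≤ D.toENNReal := by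
      rwa [EReal.toENNReal_of_ne_top hDtop]
    have hLJ : EulerianLifting.lifting W μ ≤ EulerianLifting.energy W μ J := iInf₂_le J hJ
    refine ⟨?_, fun _ => ⟨J, hJ, le_antisymm (hJle'.trans hDle) hLJ⟩⟩
    rw [le_antisymm (hLJ.trans hJle') hDle, hDn]
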